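/- Let $n\ge 1$, let $\mathfrak{gl}_{2n}=\mathfrak{gl}_{2n}(\mathbb{C})$ with matrix units $E_{i,j}$, and put $E_i=E_{i,i+1}$, $F_i=E_{i+1,i}$ $(1\le i\le 2n-1)$ and $H_i=E_{i,i}$ $(1\le i\le 2n)$. Let $\theta$ be the Lie algebra automorphism of $\mathfrak{gl}_{2n}$ with $\theta(E_i)=F_{2n-i}$, $\theta(F_i)=E_{2n-i}$, $\theta(H_i)=H_{2n+1-i}$, and let $\mathfrak{gl}_{2n}^{\theta}=\{x\in\mathfrak{gl}_{2n} : \theta(x)=x\}$. Define the following elements of $\mathfrak{gl}_{2n}^{\theta}$: $$\mathbf e_i=E_i+F_{2n-i},\quad \mathbf f_i=F_i+E_{2n-i}\quad(1\le i\le n-1),\qquad \mathbf t=E_n+F_n,\qquad \mathbf d_i=H_i+H_{2n+1-i}\quad(1\le i\le n).$$ Then the universal enveloping algebra $U(\mathfrak{gl}_{2n}^{\theta})$ is generated, as an associative unital $\mathbb{C}$-algebra, by $\mathbf e_1,\dots,\mathbf e_{n-1}$, $\mathbf f_1,\dots,\mathbf f_{n-1}$, $\mathbf t$, $\mathbf d_1,\dots,\mathbf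 d_n$, and the following is a complete set of defining relations among these generators (all indices of $\mathbf e,\mathbf f$ range over $1,\dots,n-1$ and all indices of $\mathbf d$ over $1,\dots,n$, unless restricted further; relations that involve $\mathbf e_{n-1}$ or $\mathbf f_{n-1}$ are absent when $n=1$): (R1) $\mathbf t\mathbf d_i=\mathbf d_i\mathbf t$; $\ \mathbf d_i\mathbf e_j-\mathbf e_j\mathbf d_i=(\delta_{i,j}-\delta_{i,j+1})\mathbf e_j$; $\ \mathbf d_i\mathbf f_j-\mathbf f_j\mathbf d_i=(-\delta_{i,j}+\delta_{i,j+1})\mathbf f_j$. (R2) $\mathbf t\mathbf e_i=\mathbf e_i\mathbf t$ and $\mathbf t\mathbf f_i=\mathbf f_i\mathbf t$ for $1\le i\le n-2$; $\ \mathbf e_i\mathbf e_j=\mathbf e_j\mathbf e_i$ and $\mathbf f_i\mathbf f_j=\mathbf f_j\mathbf f_i$ for $|i-j|>1$; $\ \mathbf e_i\mathbf f_j-\mathbf f_j\mathbf e_i=\delta_{i,j}(\mathbf d_i-\mathbf d_{i+1})$. (R3) $\mathbf e_i^2\mathbf e_j-2\mathbf e_i\mathbf e_j\mathbf e_i+\mathbf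 e_j\mathbf e_i^2=0$ and $\mathbf f_i^2\mathbf f_j-2\mathbf f_i\mathbf f_j\mathbf f_i+\mathbf f_j\mathbf f_i^2=0$ for $|i-j|=1$; $\ \mathbf e_{n-1}^2\mathbf t-2\mathbf e_{n-1}\mathbf t\mathbf e_{n-1}+\mathbf t\mathbf e_{n-1}^2=0$; $\ \mathbf f_{n-1}^2\mathbf t-2\mathbf f_{n-1}\mathbf t\mathbf f_{n-1}+\mathbf t\mathbf f_{n-1}^2=0$. (R4) $\mathbf e_{n-1}\mathbf t^2-2\mathbf t\mathbf e_{n-1}\mathbf t+\mathbf t^2\mathbf e_{n-1}=\mathbf e_{n-1}$; $\ \mathbf f_{n-1}\mathbf t^2-2\mathbf t\mathbf f_{n-1}\mathbf t+\mathbf t^2\mathbf f_{n-1}=\mathbf f_{n-1}$. -/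

import Mathlib

namespace EvenFixedPoint

attribute [local instance 100] LieRing.ofAssociativeRing

/-! ### The involution on `gl_{2n}` and its fixed points -/

/-- The Lie algebra `gl_{2n}(ℂ)` of complex `2n × 2n` matrices with the commutator bracket. -/
abbrev Gl (n : ℕ) : Type := Matrix (Fin (2 * n)) (Fin (2 * n)) ℂ

/-- The matrix unit `E_{i,j}` of `gl_{2n}`, with rows and columns numbered `1, …, 2n`. -/
def matUnit (n i j : ℕ) : Gl n :=
  Matrix.of fun a b => if (a : ℕ) + 1 = i ∧ (b : ℕ) + 1 = j then 1 else 0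

/-- The Chevalley generator `E_i = E_{i,i+1}`, `1 ≤ i ≤ 2n - 1`. -/
def chevE (n i : ℕ) : Gl n := matUnit n i (i + 1)

/-- The Chevalley generator `F_i = E_{i+1,i}`, `1 ≤ i ≤ 2n - 1`. -/
def chevF (n i : ℕ) : Gl n := matUnit n (i + 1) i

/-- The Chevalley generator `H_i = E_{i,i}`, `1 ≤ i ≤ 2n`. -/
def chevH (n i : ℕ) : Gl n := matUnit n i i

/-- The Lie algebra automorphism `θ` of `gl_{2n}(ℂ)` that reverses the order of the basis,
`E_{i,j} ↦ E_{2n+1-i,2n+1-j}`. It is the one with `θ(E_i) = F_{2n-i}`, `θ(F_i) = E_{2n-i}`,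
`θ(H_i) = H_{2n+1-i}`; see `theta_chevE`, `theta_chevF` and `theta_chevH` below. -/
def theta (n : ℕ) : Gl n ≃ₗ⁅ℂ⁆ Gl n := Matrix.reindexLieEquiv Fin.revPerm

theorem theta_matUnit (n i j : ℕ) (hi : i ≤ 2 * n) (hj : j ≤ 2 * n) :
    theta n (matUnit n i j) = matUnit n (2 * n + 1 - i) (2 * n + 1 - j) := by
  ext a b
  have ha := a.2
  have hb := b.2
  simp only [theta, matUnit, Matrix.reindexLieEquiv_apply, Matrix.reindex_apply,
    Matrix.submatrix_apply, Matrix.of_apply, Fin.revPerm_symm, Fin.revPerm_apply, Fin.val_rev]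
  congr 1
  apply propext
  constructor <;> rintro ⟨h1, h2⟩ <;> constructor <;> omega

theorem theta_chevE (n i : ℕ) (h : i + 1 ≤ 2 * n) :
    theta n (chevE n i) = chevF n (2 * n - i) := by
  rw [chevE, chevF, theta_matUnit n _ _ (by omega) h]
  congr 1 <;> omega

theorem theta_chevF (n i : ℕ) (h : i + 1 ≤ 2 * n) :
    theta n (chevF n i) = chevE n (2 * n - i) := by
  rw [chevE, chevF, theta_matUnit n _ _ h (by omega)]
  congr 1 <;> omega

theorem theta_chevH (n i : ℕ) (h : i ≤ 2 * n) :
    theta n (chevH n i) = chevH n (2 * n + 1 - i) :=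
  theta_matUnit n _ _ h h

/-- The fixed-point subalgebra `gl_{2n}^θ = {x | θ x = x}`. -/
def fixedSubalgebra (n : ℕ) : LieSubalgebra ℂ (Gl n) where
  carrier := {x | theta n x = x}
  add_mem' {x y} hx hy := by
    simp only [Set.mem_ofPred_eq] at hx hy ⊢
    rw [map_add, hx, hy]
  zero_mem' := map_zero _
  smul_mem' c x hx := by
    simp only [Set.mem_ofPred_eq] at hx ⊢
    rw [map_smul, hx]
  lie_mem' {x y} hx hy := by
    have hx' : theta n x = x := hx
    have hy' : theta n y = y := hy
    change theta n ⁅x, y⁆ = ⁅x, y⁆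
    rw [LieEquiv.map_lie, hx', hy']

theorem mem_fixedSubalgebra (n : ℕ) (x : Gl n) : x ∈ fixedSubalgebra n ↔ theta n x = x :=
  Iff.rfl

/-! ### The generators -/

/-- The generating symbols. The index `i` starts at `0`: `e i`, `f i`, `d i` stand for
`e_{i+1}`, `f_{i+1}`, `d_{i+1}`. -/
inductive Gen (n : ℕ) : Type
  | e (i : Fin (n - 1))
  | f (i : Fin (n - 1))
  | t
  | d (i : Fin n)

/-- The matrices `e_i = E_i + F_{2n-i}`, `f_i = F_i + E_{2n-i}` (`1 ≤ i ≤ n - 1`),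
`t = E_n + F_n` and `d_i = H_i + H_{2n+1-i}` (`1 ≤ i ≤ n`). -/
def genMat (n : ℕ) : Gen n → Gl n
  | .e i => chevE n (i + 1) + chevF n (2 * n - (i + 1))
  | .f i => chevF n (i + 1) + chevE n (2 * n - (i + 1))
  | .t => chevE n n + chevF n n
  | .d i => chevH n (i + 1) + chevH n (2 * n + 1 - (i + 1))

theorem genMat_mem (n : ℕ) (g : Gen n) : genMat n g ∈ fixedSubalgebra n := by
  rw [mem_fixedSubalgebra]
  cases g with
  | e i =>
    have hi := i.2
    rw [genMat, map_add, theta_chevE n _ (by omega), theta_chevF n _ (by omega),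
      show 2 * n - (2 * n - ((i : ℕ) + 1)) = i + 1 by omega, add_comm]
  | f i =>
    have hi := i.2
    rw [genMat, map_add, theta_chevE n _ (by omega), theta_chevF n _ (by omega),
      show 2 * n - (2 * n - ((i : ℕ) + 1)) = i + 1 by omega, add_comm]
  | t =>
    rcases Nat.eq_zero_or_pos n with rfl | hn
    · ext a b
      exact absurd a.2 (by omega)
    · rw [genMat, map_add, theta_chevE n _ (by omega), theta_chevF n _ (by omega),
        show 2 * n - n = n by omega, add_comm]
  | d i =>
    have hi := i.2
    rw [genMat, map_add, theta_chevH n _ (by omega), theta_chevH n _ (by omega),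
      show 2 * n + 1 - (2 * n + 1 - ((i : ℕ) + 1)) = i + 1 by omega, add_comm]

/-- The universal enveloping algebra `U(gl_{2n}^θ)`. -/
abbrev Ui (n : ℕ) : Type := UniversalEnvelopingAlgebra ℂ (fixedSubalgebra n)

/-- The elements `e_i`, `f_i`, `t`, `d_i` of `U(gl_{2n}^θ)`. -/
noncomputable def genU (n : ℕ) (g : Gen n) : Ui n :=
  UniversalEnvelopingAlgebra.ι ℂ (⟨genMat n g, genMat_mem n g⟩ : fixedSubalgebra n)

/-! ### The presentation -/

/-- The free associative unital algebra on the symbols. -/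
abbrev Free (n : ℕ) : Type := FreeAlgebra ℂ (Gen n)

section Symbols

variable {n : ℕ}

noncomputable def e (i : Fin (n - 1)) : Free n := FreeAlgebra.ι ℂ (Gen.e i)

noncomputable def f (i : Fin (n - 1)) : Free n := FreeAlgebra.ι ℂ (Gen.f i)

noncomputable def t : Free n := FreeAlgebra.ι ℂ Gen.t

noncomputable def d (i : Fin n) : Free n := FreeAlgebra.ι ℂ (Gen.d i)

end Symbols

/-- Kronecker's `δ_{i,j}`. -/
def delta (i j : ℕ) : ℂ := if i = j then 1 else 0

/-- The defining relations. Since the indices start at `0`, the conditions `1 ≤ i ≤ n - 2` and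
`i = n - 1` on an index of an `e` or `f` read `i + 2 < n` and `i + 2 = n`. -/
inductive Rel (n : ℕ) : Free n → Free n → Prop
  -- (R1)
  | t_d (i : Fin n) : Rel n (t * d i) (d i * t)
  | d_e (i : Fin n) (j : Fin (n - 1)) :
      Rel n (d i * e j - e j * d i) ((delta i j - delta i (j + 1)) • e j)
  | d_f (i : Fin n) (j : Fin (n - 1)) :
      Rel n (d i * f j - f j * d i) ((-delta i j + delta i (j + 1)) • f j)
  -- (R2)
  | t_e (i : Fin (n - 1)) (hi : (i : ℕ) + 2 < n) : Rel n (t * e i) (e i * t)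
  | t_f (i : Fin (n - 1)) (hi : (i : ℕ) + 2 < n) : Rel n (t * f i) (f i * t)
  | e_e (i j : Fin (n - 1)) (hij : 1 < |(i : ℤ) - (j : ℤ)|) : Rel n (e i * e j) (e j * e i)
  | f_f (i j : Fin (n - 1)) (hij : 1 < |(i : ℤ) - (j : ℤ)|) : Rel n (f i * f j) (f j * f i)
  | e_f (i j : Fin (n - 1)) :
      Rel n (e i * f j - f j * e i)
        (delta i j • (d ⟨i, by omega⟩ - d ⟨i + 1, by omega⟩))
  -- (R3): Serre relations among the `e`, among the `f`, and with `t`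
  | serre_e (i j : Fin (n - 1)) (hij : |(i : ℤ) - (j : ℤ)| = 1) :
      Rel n (e i ^ 2 * e j - 2 * (e i * e j * e i) + e j * e i ^ 2) 0
  | serre_f (i j : Fin (n - 1)) (hij : |(i : ℤ) - (j : ℤ)| = 1) :
      Rel n (f i ^ 2 * f j - 2 * (f i * f j * f i) + f j * f i ^ 2) 0
  | e_e_t (i : Fin (n - 1)) (hi : (i : ℕ) + 2 = n) :
      Rel n (e i ^ 2 * t - 2 * (e i * t * e i) + t * e i ^ 2) 0
  | f_f_t (i : Fin (n - 1)) (hi : (i : ℕ) + 2 = n) :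
      Rel n (f i ^ 2 * t - 2 * (f i * t * f i) + t * f i ^ 2) 0
  -- (R4)
  | e_t_t (i : Fin (n - 1)) (hi : (i : ℕ) + 2 = n) :
      Rel n (e i * t ^ 2 - 2 * (t * e i * t) + t ^ 2 * e i) (e i)
  | f_t_t (i : Fin (n - 1)) (hi : (i : ℕ) + 2 = n) :
      Rel n (f i * t ^ 2 - 2 * (t * f i * t) + t ^ 2 * f i) (f i)

/-- The associative unital algebra with generators `e_i`, `f_i`, `t`, `d_i` and relations `Rel`. -/
abbrev Presented (n : ℕ) : Type := RingQuot (Rel n)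

/-- The class of a generating symbol in the presented algebra. -/
noncomputable def Presented.gen (n : ℕ) (g : Gen n) : Presented n :=
  RingQuot.mkAlgHom ℂ (Rel n) (FreeAlgebra.ι ℂ g)

end EvenFixedPoint

/-! Pairing the index `i` with `2n + 1 - i` turns `θ` into the swap of two blocks, so a fixed matrix
has the block form `(a b; b a)`. It may be read as `a + ε b` with `ε² = 1`, which identifies
`gl_{2n}^θ` with `gl_n ⊗ ℂ[ε]/(ε² - 1)`. Here `e_i`, `f_i`, `d_i` are the usual Chevalley generators
of `gl_n`, and `t` is `ε E_{n,n}`.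

For the relations to be complete, elements `X i j` and `B i j` are needed in the presented algebra
that commute like `E_{i,j}` and `ε E_{i,j}` (`IsDoubledUnits`). The `X i j` come from the relations
without `t`: `IsMatUnits.extendUnits` adds one row and one column at a time, and
`IsChevalley.exists_isMatUnits` iterates this. The `B i j` are brackets of `t` with the `X i j`
(`twist`). The relations (R3) with `t` give `[X, B] = B` (`IsMatUnits.lie_twist`), and (R4) then
gives `[B, B] = X` (`IsMatUnits.twist_lie_twist`). In each case a relation at a single neighbour `p`
of the last index `N` spreads to all indices through the action of matrix units that kill the new
generator.

Such families define a Lie homomorphism out of `gl_{2n}^θ` (`IsDoubledUnits.toLieHom`), hence an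
algebra map out of the enveloping algebra. The map in the other direction exists because doubled
units satisfy the relations (`IsDoubledUnits.lift_eq_of_rel`). Both maps match generators, so they
are mutually inverse. -/

namespace EvenFixedPoint

attribute [local instance 100] LieRing.ofAssociativeRing

/-! ### Matrix units in a Lie ring, and the Serre presentation of `gl_n`. -/

section MatUnits

variable {L : Type*} [LieRing L] {ι : Type*} [DecidableEq ι]

/-- A family of elements of a Lie ring with the commutation relations of matrix units. -/
def IsMatUnits (X : ι → ι → L) : Prop :=
  ∀ i j k l, ⁅X i j, X k l⁆ = (if j = k then X i l else 0) - (if l = i then X k j else 0)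

/-- Negative transpose is an automorphism of `gl`. Through it, every statement about columns yields
one about rows. -/
theorem IsMatUnits.neg_transpose {X : ι → ι → L} (hX : IsMatUnits X) :
    IsMatUnits fun i j => -X j i := by
  intro i j k l
  simp only [lie_neg, neg_lie, neg_neg, hX j i l k]
  grind

theorem IsMatUnits.comp {κ : Type*} [DecidableEq κ] {X : ι → ι → L} (hX : IsMatUnits X)
    {g : κ → ι} (hg : Function.Injective g) : IsMatUnits fun i j => X (g i) (g j) := by
  intro i j k l
  simp only [hX (g i), hg.eq_iff]

theorem lie_eq_zero_of_lie {x y z : L} (hx : ⁅x, z⁆ = 0) (hy : ⁅y, z⁆ = 0) : ⁅⁅x, y⁆, z⁆ = 0 := by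
  rw [lie_lie, hx, hy, lie_zero, lie_zero, sub_zero]

theorem lie_lie_right (x y : L) : ⁅⁅x, y⁆, y⁆ = ⁅y, ⁅y, x⁆⁆ := by
  rw [← lie_skew, ← lie_skew x y, lie_neg, neg_neg]

/-- Polarization of the relation `[X_{pN}, [X_{pN}, t]] = 0`. -/
theorem IsMatUnits.lie_lie_eq_zero [IsAddTorsionFree L] {X : ι → ι → L} (hX : IsMatUnits X)
    {N p : ι} {t : L} (ht : ∀ k l, k ≠ N → l ≠ N → ⁅X k l, t⁆ = 0) (hp : p ≠ N)
    (h : ⁅X p N, ⁅X p N, t⁆⁆ = 0) (i j : ι) (hi : i ≠ N) (hj : j ≠ N) :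
    ⁅X i N, ⁅X j N, t⁆⁆ = 0 := by
  have act : ∀ k l i j, k ≠ N → l ≠ N → i ≠ N → j ≠ N → ⁅X k l, ⁅X i N, ⁅X j N, t⁆⁆⁆ =
      (if l = i then ⁅X k N, ⁅X j N, t⁆⁆ else 0) + (if l = j then ⁅X i N, ⁅X k N, t⁆⁆ else 0) := by
    intro k l i j hk hl hi hj
    rw [leibniz_lie, leibniz_lie (X k l) (X j N), ht k l hk hl, hX k l, hX k l]
    simp only [hk.symm, if_false, sub_zero, lie_zero, add_zero]
    split_ifs <;> simp
  have symm : ∀ i j, i ≠ N → j ≠ N → ⁅X i N, ⁅X j N, t⁆⁆ = ⁅X j N, ⁅X i N, t⁆⁆ := by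
    intro i j hi hj
    rw [leibniz_lie, hX, if_neg hj.symm, if_neg hi.symm, sub_zero, zero_lie, zero_add]
  -- Write `Q(i,j)` for the double bracket, symmetric by `symm`. Acting with `X i p` on `Q(p,p) = 0`
  -- gives `2 Q(i,p) = 0`; acting below with `X j p` on `Q(i,p) = 0` gives `Q(i,j) = 0`.
  have hip : ∀ i, i ≠ N → ⁅X i N, ⁅X p N, t⁆⁆ = 0 := by
    intro i hi
    have := act i p p p hi hp hp hp
    rw [h, lie_zero, if_pos rfl, if_pos rfl, symm p i hp hi, ← two_nsmul] at this
    exact (smul_eq_zero_iff_right two_ne_zero).1 this.symm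
  by_cases hip' : i = p
  · subst hip'
    rw [symm i j hi hj, hip j hj]
  · have := act j p i p hj hp hi hp
    rw [hip i hi, lie_zero, if_neg (Ne.symm hip'), if_pos rfl, zero_add] at this
    exact this.symm

/-! ### Adding one row and one column -/

section Row

variable {X : ι → ι → L} (hX : IsMatUnits X) {N : ι} {e : L}
  (he : ∀ i j, j ≠ N → ⁅X i j, e⁆ = 0) (heN : ⁅X N N, e⁆ = e)
  (hs : (∀ i, i = N) ∨ ∃ p, p ≠ N ∧ ⁅X p N, ⁅X p N, e⁆⁆ = 0 ∧ ⁅⁅X p N, e⁆, e⁆ = 0)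

include hX he heN hs

/-- With `e` in the role of `E_{N,*}`, the brackets `⁅X k N, e⁆` form the new column, on which the
matrix units act as on the standard basis of the vector representation. Only the case `j = N`, `i, k
≠ N` needs the Serre relation, in polarized form. -/
theorem IsMatUnits.lie_row [IsAddTorsionFree L] (i j k : ι) :
    ⁅X i j, ⁅X k N, e⁆⁆ = if j = k then ⁅X i N, e⁆ else 0 := by
  by_cases hj : j = N
  · subst hj
    by_cases hk : k = j
    · subst hk
      rw [heN, if_pos rfl]
    · rw [if_neg (Ne.symm hk)]
      by_cases hi : i = j
      · subst hi
        rw [leibniz_lie, heN, hX, if_neg (Ne.symm hk), if_pos rfl, zero_sub, neg_lie,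
          neg_add_cancel]
      · rcases hs with hs | ⟨p, hp, h1, -⟩
        · exact absurd (hs k) hk
        · exact hX.lie_lie_eq_zero (fun k l _ hl => he k l hl) hp h1 i k hi hk
  · rw [leibniz_lie, he i j hj, lie_zero, add_zero, hX, sub_lie]
    have := he k j hj
    split_ifs <;> simp [this]

/-- The entries of the new column commute: `X i p` kills `e` and carries the Serre relation from `p`
to `i`, giving `⁅⁅X i N, e⁆, e⁆ = 0`; applying `X k N` to this replaces the outer `e` by the `k`-th
entry. -/
theorem IsMatUnits.row_row [IsAddTorsionFree L] (i k : ι) : ⁅⁅X i N, e⁆, ⁅X k N, e⁆⁆ = 0 := by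
  have row := hX.lie_row he heN hs
  have key : ∀ i, ⁅⁅X i N, e⁆, e⁆ = 0 := by
    intro i
    rcases hs with hs | ⟨p, hp, -, h2⟩
    · rw [hs i, heN, lie_self]
    · have := leibniz_lie (X i p) ⁅X p N, e⁆ e
      rw [h2, lie_zero, row, if_pos rfl, he i p hp, lie_zero, add_zero] at this
      exact this.symm
  have := leibniz_lie (X k N) ⁅X i N, e⁆ e
  rw [key, lie_zero, row] at this
  have h2 : ⁅(if N = i then ⁅X k N, e⁆ else 0), e⁆ = 0 := by
    split_ifs
    · exact key k
    · simp
  rw [h2, zero_add] at this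
  exact this.symm

end Row

/-- The family of matrix units enlarged by a row and a column. -/
def extendUnits (X : ι → ι → L) (N : ι) (e f D : L) : Option ι → Option ι → L
  | some i, some j => X i j
  | some i, none => ⁅X i N, e⁆
  | none, some j => ⁅f, X N j⁆
  | none, none => D

/-- Here `e`, `f`, `D` play `E_{N,*}`, `E_{*,N}`, `E_{*,*}` for the new index `*`. Beyond the action
on the new column and row, the essential bracket is that of a column entry with a row entry, which
reduces to `⁅e, f⁆` by the Jacobi identity. -/
theorem IsMatUnits.extendUnits [IsAddTorsionFree L] {X : ι → ι → L} (hX : IsMatUnits X) {N : ι}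
    {e f D : L} (he : ∀ i j, j ≠ N → ⁅X i j, e⁆ = 0) (heN : ⁅X N N, e⁆ = e)
    (hse : (∀ i, i = N) ∨ ∃ p, p ≠ N ∧ ⁅X p N, ⁅X p N, e⁆⁆ = 0 ∧ ⁅⁅X p N, e⁆, e⁆ = 0)
    (hf : ∀ i j, i ≠ N → ⁅f, X i j⁆ = 0) (hfN : ⁅f, X N N⁆ = f)
    (hsf : (∀ i, i = N) ∨ ∃ p, p ≠ N ∧ ⁅X N p, ⁅X N p, f⁆⁆ = 0 ∧ ⁅⁅X N p, f⁆, f⁆ = 0)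
    (hD : ∀ i j, ⁅X i j, D⁆ = 0) (hDe : ⁅D, e⁆ = -e) (hDf : ⁅D, f⁆ = f)
    (hef : ⁅e, f⁆ = X N N - D) : IsMatUnits (extendUnits X N e f D) := by
  have hu := hX.lie_row he heN hse
  have huu := hX.row_row he heN hse
  -- The new row for `X` is the new column for the negative transpose of `X`.
  have hf' : ∀ i j, j ≠ N → ⁅-X j i, f⁆ = 0 := fun i j hj => by rw [neg_lie, lie_skew, hf j i hj]
  have hfN' : ⁅-X N N, f⁆ = f := by rw [neg_lie, lie_skew, hfN]
  have hsf' : (∀ i, i = N) ∨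
      ∃ p, p ≠ N ∧ ⁅-X N p, ⁅-X N p, f⁆⁆ = 0 ∧ ⁅⁅-X N p, f⁆, f⁆ = 0 := by
    simpa only [neg_lie, lie_neg, neg_neg, neg_eq_zero] using hsf
  have hv := hX.neg_transpose.lie_row hf' hfN' hsf'
  have hvv := hX.neg_transpose.row_row hf' hfN' hsf'
  simp only [neg_lie, lie_skew] at hv hvv
  have hv : ∀ i j k, ⁅X i j, ⁅f, X N k⁆⁆ = -(if i = k then ⁅f, X N j⁆ else 0) := by
    intro i j k
    rw [← hv, lie_skew]
  have hDX : ∀ i j, ⁅D, X i j⁆ = 0 := fun i j => by rw [← lie_skew, hD, neg_zero]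
  have hDu : ∀ i, ⁅D, ⁅X i N, e⁆⁆ = -⁅X i N, e⁆ := by
    intro i
    rw [leibniz_lie, hDX, hDe, zero_lie, zero_add, lie_neg]
  have hDv : ∀ i, ⁅D, ⁅f, X N i⁆⁆ = ⁅f, X N i⁆ := by
    intro i
    rw [leibniz_lie, hDX, hDf, lie_zero, add_zero]
  have hev : ∀ j, ⁅e, ⁅f, X N j⁆⁆ = X N j - if j = N then D else 0 := by
    intro j
    by_cases hj : j = N
    · subst hj
      rw [hfN, hef, if_pos rfl]
    · have h1 : ⁅e, X N j⁆ = 0 := by rw [← lie_skew, he N j hj, neg_zero]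
      rw [leibniz_lie, hef, h1, lie_zero, sub_lie, hDX, hX, if_pos rfl, if_neg hj, if_neg hj]
      simp
  have huv : ∀ i j, ⁅⁅X i N, e⁆, ⁅f, X N j⁆⁆ = X i j - if j = i then D else 0 := by
    intro i j
    by_cases hi : i = N
    · subst hi
      rw [heN, hev]
    · rw [lie_lie, hev, hv, lie_sub, hX, if_pos rfl]
      by_cases hj : j = i
      · subst hj
        simp only [if_true, hi, if_false, lie_zero, hfN, lie_neg, hef]
        abel
      · have : ⁅X i N, if j = N then D else 0⁆ = 0 := by
          split_ifs <;> simp [hD]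
        simp [this, hj, Ne.symm hj]
  have hvu : ∀ i j, ⁅⁅f, X N j⁆, ⁅X i N, e⁆⁆ = (if j = i then D else 0) - X i j := by
    intro i j
    rw [← lie_skew, huv, neg_sub]
  have huX : ∀ i j k, ⁅⁅X k N, e⁆, X i j⁆ = -(if j = k then ⁅X i N, e⁆ else 0) := by
    intro i j k
    rw [← lie_skew, hu]
  have hvX : ∀ i j k, ⁅⁅f, X N k⁆, X i j⁆ = if i = k then ⁅f, X N j⁆ else 0 := by
    intro i j k
    rw [← lie_skew, hv, neg_neg]
  have huD : ∀ i, ⁅⁅X i N, e⁆, D⁆ = ⁅X i N, e⁆ := by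
    intro i
    rw [← lie_skew, hDu, neg_neg]
  have hvD : ∀ i, ⁅⁅f, X N i⁆, D⁆ = -⁅f, X N i⁆ := by
    intro i
    rw [← lie_skew, hDv]
  rintro (_ | i) (_ | j) (_ | k) (_ | l) <;>
    simp only [EvenFixedPoint.extendUnits, hX _ _, hu, hv, huu, hvv, hDu, hDv, huv, hvu, huX, hvX,
      huD, hvD, hD, hDX, lie_self, Option.some.injEq, reduceCtorEq, if_true, if_false, sub_zero,
      zero_sub, sub_self, eq_comm]

/-! ### Chevalley generators -/

/-- `E_{i,j+1} = [E_{i,j}, E_{j,j+1}]`. The hypothesis only concerns simple root vectors between `i`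
and `j`, since in the applications the others need not satisfy `p`. -/
theorem IsMatUnits.mem_of_lt {n : ℕ} {X : Fin n → Fin n → L} (hX : IsMatUnits X) {p : L → Prop}
    (hp : ∀ x y, p x → p y → p ⁅x, y⁆) {i j : Fin n} (hij : i < j)
    (h : ∀ k l : Fin n, (l : ℕ) = k + 1 → i ≤ k → l ≤ j → p (X k l)) : p (X i j) := by
  obtain ⟨j, hj⟩ := j
  induction j with
  | zero => exact absurd hij (by simp [Fin.lt_def])
  | succ j ih =>
    have hj' : j < n := by omega
    by_cases hi : (i : ℕ) = j
    · exact h i ⟨j + 1, hj⟩ (by simp [hi]) le_rfl le_rfl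
    · have hlt : i < ⟨j, hj'⟩ := by simp only [Fin.lt_def] at hij ⊢; omega
      have h1 := ih hj' hlt fun k l hkl hk hl => h k l hkl hk
        (by simp only [Fin.le_def] at hl ⊢; omega)
      have h2 := h ⟨j, hj'⟩ ⟨j + 1, hj⟩ rfl hlt.le le_rfl
      have h3 := hp _ _ h1 h2
      rwa [hX, if_pos rfl, if_neg (Fin.ne_of_gt hij), sub_zero] at h3

theorem IsMatUnits.mem_of_gt {n : ℕ} {X : Fin n → Fin n → L} (hX : IsMatUnits X) {p : L → Prop}
    (hp : ∀ x y, p x → p y → p ⁅x, y⁆) {i j : Fin n} (hij : j < i)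
    (h : ∀ k l : Fin n, (l : ℕ) = k + 1 → j ≤ k → l ≤ i → p (X l k)) : p (X i j) := by
  have := hX.neg_transpose.mem_of_lt (p := fun x => p (-x)) (i := j) (j := i)
    (fun x y hx hy => by
      have := hp _ _ hy hx
      rwa [lie_neg, neg_lie, neg_neg, ← lie_skew] at this)
    hij (fun k l hkl hk hl => by simpa using h k l hkl hk hl)
  simpa using this

/-- The Serre presentation of `gl_n`, without the relations `[d_i, d_j] = 0`, which follow. -/
structure IsChevalley (n : ℕ) (d e f : ℕ → L) : Prop where
  d_e : ∀ i j, i < n → j + 1 < n →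
    ⁅d i, e j⁆ = (if i = j then e j else 0) - (if i = j + 1 then e j else 0)
  d_f : ∀ i j, i < n → j + 1 < n →
    ⁅d i, f j⁆ = (if i = j + 1 then f j else 0) - (if i = j then f j else 0)
  e_f : ∀ i j, i + 1 < n → j + 1 < n → ⁅e i, f j⁆ = if i = j then d i - d (i + 1) else 0
  e_e : ∀ i j, i + 1 < j → j + 1 < n → ⁅e i, e j⁆ = 0
  f_f : ∀ i j, i + 1 < j → j + 1 < n → ⁅f i, f j⁆ = 0
  serre_e : ∀ i, i + 2 < n → ⁅e i, ⁅e i, e (i + 1)⁆⁆ = 0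
  serre_e' : ∀ i, i + 2 < n → ⁅e (i + 1), ⁅e (i + 1), e i⁆⁆ = 0
  serre_f : ∀ i, i + 2 < n → ⁅f i, ⁅f i, f (i + 1)⁆⁆ = 0
  serre_f' : ∀ i, i + 2 < n → ⁅f (i + 1), ⁅f (i + 1), f i⁆⁆ = 0

theorem IsChevalley.mono {m n : ℕ} {d e f : ℕ → L} (h : IsChevalley n d e f) (hm : m ≤ n) :
    IsChevalley m d e f where
  d_e i j _ _ := h.d_e i j (by omega) (by omega)
  d_f i j _ _ := h.d_f i j (by omega) (by omega)
  e_f i j _ _ := h.e_f i j (by omega) (by omega)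
  e_e i j _ _ := h.e_e i j (by omega) (by omega)
  f_f i j _ _ := h.f_f i j (by omega) (by omega)
  serre_e i _ := h.serre_e i (by omega)
  serre_e' i _ := h.serre_e' i (by omega)
  serre_f i _ := h.serre_f i (by omega)
  serre_f' i _ := h.serre_f' i (by omega)

/-- The weights of `e k` and `f k` are opposite, so `d i` commutes with `⁅e k, f k⁆ = d k - d (k +
1)`. Thus `⁅d i, d k⁆` does not depend on `k`, and it vanishes at `k = i`. -/
theorem IsChevalley.d_d {n : ℕ} {d e f : ℕ → L} (h : IsChevalley n d e f) (i j : ℕ) (hi : i < n)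
    (hj : j < n) : ⁅d i, d j⁆ = 0 := by
  have step : ∀ k, k + 1 < n → ⁅d i, d k⁆ = ⁅d i, d (k + 1)⁆ := by
    intro k hk
    have h1 := leibniz_lie (d i) (e k) (f k)
    rw [h.e_f k k hk hk, if_pos rfl, h.d_e i k hi hk, h.d_f i k hi hk, lie_sub] at h1
    rw [← sub_eq_zero, h1]
    have h2 : ⁅e k, f k⁆ + ⁅f k, e k⁆ = 0 := by rw [← lie_skew, neg_add_cancel]
    have h3 : ⁅f k, e k⁆ + ⁅e k, f k⁆ = 0 := by rw [add_comm, h2]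
    split_ifs <;> simp [h2, h3]
  have h0 : ∀ k, k < n → ⁅d i, d k⁆ = ⁅d i, d 0⁆ := by
    intro k
    induction k with
    | zero => intro _; rfl
    | succ k ih => intro hk; rw [← step k hk, ih (by omega)]
  rw [h0 j hj, ← h0 i hi, lie_self]

theorem IsChevalley.exists_isMatUnits [IsAddTorsionFree L] {n : ℕ} {d e f : ℕ → L}
    (h : IsChevalley n d e f) : ∃ X : Fin n → Fin n → L, IsMatUnits X ∧ (∀ i, X i i = d i) ∧
      ∀ i j : Fin n, (j : ℕ) = i + 1 → X i j = e i ∧ X j i = f i := by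
  induction n with
  | zero => exact ⟨fun _ _ => 0, fun i => i.elim0, fun i => i.elim0, fun i => i.elim0⟩
  | succ m ih =>
    obtain ⟨X, hX, hd, hef⟩ := ih (h.mono m.le_succ)
    rcases m with _ | m
    · refine ⟨fun _ _ => d 0, fun i j k l => ?_, fun i => ?_, fun i j hij => ?_⟩
      · rw [if_pos (by omega), if_pos (by omega), lie_self, sub_self]
      · rw [show (i : ℕ) = 0 by omega]
      · omega
    have hXX : ∀ (z : L) (i j : Fin (m + 1)),
        (∀ k, i < j → i ≤ k → (k : ℕ) + 1 ≤ j → ⁅e k, z⁆ = 0) →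
        (∀ k, j < i → j ≤ k → (k : ℕ) + 1 ≤ i → ⁅f k, z⁆ = 0) → (i = j → ⁅d i, z⁆ = 0) →
        ⁅X i j, z⁆ = 0 := by
      intro z i j h1 h2 h3
      rcases lt_trichotomy i j with hij | hij | hij
      · refine hX.mem_of_lt (p := fun x => ⁅x, z⁆ = 0) (fun x y => lie_eq_zero_of_lie) hij ?_
        intro k l hkl hk hl
        rw [(hef k l hkl).1]
        exact h1 k hij hk (by rw [← hkl]; exact hl)
      · subst hij
        rw [hd, h3 rfl]
      · refine hX.mem_of_gt (p := fun x => ⁅x, z⁆ = 0) (fun x y => lie_eq_zero_of_lie) hij ?_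
        intro k l hkl hk hl
        rw [(hef k l hkl).2]
        exact h2 k hij hk (by rw [← hkl]; exact hl)
    have hext : IsMatUnits (EvenFixedPoint.extendUnits X (Fin.last m) (e m) (f m) (d (m + 1))) := by
      apply hX.extendUnits
      · intro i j hj
        rw [ne_eq, Fin.ext_iff, Fin.val_last] at hj
        refine hXX _ i j (fun k _ _ hk => ?_) (fun k _ _ hk => ?_) (fun hij => ?_)
        · exact h.e_e k m (by omega) (by omega)
        · rw [← lie_skew, h.e_f m k (by omega) (by omega), if_neg (by omega), neg_zero]
        · subst hij
          rw [h.d_e i m (by omega) (by omega), if_neg hj, if_neg (by omega), sub_zero]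
      · rw [hd, Fin.val_last, h.d_e m m (by omega) (by omega), if_pos rfl, if_neg (by omega),
          sub_zero]
      · rcases m with _ | m
        · exact Or.inl fun i => by omega
        -- The neighbour is the index just before the last, where `X p N` is the preceding generator
        -- and the Serre relations apply directly.
        · refine Or.inr ⟨⟨m, by omega⟩, by simp [Fin.ext_iff], ?_, ?_⟩
          · rw [(hef ⟨m, by omega⟩ (Fin.last (m + 1)) rfl).1]
            exact h.serre_e m (by omega)
          · rw [(hef ⟨m, by omega⟩ (Fin.last (m + 1)) rfl).1, lie_lie_right]
            exact h.serre_e' m (by omega)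
      · intro i j hi
        rw [ne_eq, Fin.ext_iff, Fin.val_last] at hi
        rw [← lie_skew, neg_eq_zero]
        refine hXX _ i j (fun k _ _ hk => ?_) (fun k _ _ hk => ?_) (fun hij => ?_)
        · rw [h.e_f k m (by omega) (by omega), if_neg (by omega)]
        · exact h.f_f k m (by omega) (by omega)
        · subst hij
          rw [h.d_f i m (by omega) (by omega), if_neg hi, if_neg (by omega), sub_zero]
      · rw [hd, Fin.val_last, ← lie_skew, h.d_f m m (by omega) (by omega), if_pos rfl,
          if_neg (by omega), zero_sub, neg_neg]
      · rcases m with _ | m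
        · exact Or.inl fun i => by omega
        · refine Or.inr ⟨⟨m, by omega⟩, by simp [Fin.ext_iff], ?_, ?_⟩
          · rw [(hef ⟨m, by omega⟩ (Fin.last (m + 1)) rfl).2]
            exact h.serre_f m (by omega)
          · rw [(hef ⟨m, by omega⟩ (Fin.last (m + 1)) rfl).2, lie_lie_right]
            exact h.serre_f' m (by omega)
      · intro i j
        refine hXX _ i j (fun k _ _ hk => ?_) (fun k _ _ hk => ?_) (fun hij => ?_)
        · rw [← lie_skew, h.d_e _ _ (by omega) (by omega), if_neg (by omega), if_neg (by omega),
            sub_zero, neg_zero]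
        · rw [← lie_skew, h.d_f _ _ (by omega) (by omega), if_neg (by omega), if_neg (by omega),
            sub_zero, neg_zero]
        · exact h.d_d _ _ (by omega) (by omega)
      · rw [h.d_e _ _ (by omega) (by omega), if_neg (by omega), if_pos rfl, zero_sub]
      · rw [h.d_f _ _ (by omega) (by omega), if_pos rfl, if_neg (by omega), sub_zero]
      · rw [h.e_f _ _ (by omega) (by omega), if_pos rfl, hd, Fin.val_last]
    -- The added index `none` becomes the last element of `Fin (m + 2)`.
    refine ⟨_, hext.comp (finSuccEquivLast (n := m + 1)).injective, fun i => ?_, fun i j hij => ?_⟩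
    · induction i using Fin.lastCases with
      | last => simp [EvenFixedPoint.extendUnits]
      | cast i => simp [EvenFixedPoint.extendUnits, hd]
    · induction i using Fin.lastCases with
      | last => simp only [Fin.val_last] at hij; omega
      | cast i =>
        induction j using Fin.lastCases with
        | last =>
          obtain rfl : i = Fin.last m := by
            simp only [Fin.ext_iff, Fin.val_last, Fin.val_castSucc] at hij ⊢; omega
          simp only [EvenFixedPoint.extendUnits, finSuccEquivLast_castSucc, finSuccEquivLast_last,
            hd, Fin.val_last, Fin.val_castSucc]
          rw [← lie_skew (f m), h.d_e m m (by omega) (by omega), h.d_f m m (by omega) (by omega)]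
          simp
        | cast j => simpa [EvenFixedPoint.extendUnits] using hef i j (by simpa using hij)

end MatUnits

/-! ### The family `ε E_{i,j}` built from `t = ε E_{N,N}`. -/

section Twist

variable {L : Type*} [LieRing L] {ι : Type*} [DecidableEq ι]

/-- The family `B` with `B N N = t` on which matrix units `X` act as on matrix units. -/
def twist (X : ι → ι → L) (N : ι) (t : L) (i j : ι) : L :=
  if i = N then (if j = N then t else ⁅t, X N j⁆)
  else if j = N then ⁅X i N, t⁆ else ⁅X i N, ⁅t, X N j⁆⁆ + if i = j then t else 0

variable {X : ι → ι → L} {N : ι} {t : L}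

theorem twist_self : twist X N t N N = t := by simp [twist]

theorem twist_row {j : ι} (hj : j ≠ N) : twist X N t N j = ⁅t, X N j⁆ := by simp [twist, hj]

theorem twist_col {i : ι} (hi : i ≠ N) : twist X N t i N = ⁅X i N, t⁆ := by simp [twist, hi]

theorem twist_of_ne {i j : ι} (hi : i ≠ N) (hj : j ≠ N) :
    twist X N t i j = ⁅X i N, twist X N t N j⁆ + if i = j then t else 0 := by
  simp [twist, hi, hj]

section

variable (hX : IsMatUnits X) (h0 : ∀ k l, k ≠ N → l ≠ N → ⁅X k l, t⁆ = 0) (hN : ⁅X N N, t⁆ = 0)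

include hX h0 hN

/-- A second formula for the interior entries, with `t` moved to the other factor. The two agree
because `t` commutes with `⁅X i N, X N j⁆`. -/
theorem twist_of_ne' {i j : ι} (hi : i ≠ N) (hj : j ≠ N) :
    twist X N t i j = ⁅twist X N t i N, X N j⁆ + if i = j then t else 0 := by
  rw [twist_of_ne hi hj, twist_row hj, twist_col hi, leibniz_lie, hX, if_pos rfl]
  have : ⁅t, X i j - if j = i then X N N else 0⁆ = 0 := by
    rw [← lie_skew, sub_lie, h0 i j hi hj]
    split_ifs <;> simp [hN]
  rw [this, add_zero]

/-- The action is computed on `t`, then on the column and row of `N`, where `hQ` and `hQ'` exclude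
unwanted terms; interior entries follow by the Leibniz rule. -/
theorem IsMatUnits.lie_twist (hQ : ∀ i j, i ≠ N → j ≠ N → ⁅X i N, ⁅X j N, t⁆⁆ = 0)
    (hQ' : ∀ i j, i ≠ N → j ≠ N → ⁅X N i, ⁅X N j, t⁆⁆ = 0) (k l i j : ι) :
    ⁅X k l, twist X N t i j⁆ =
      (if l = i then twist X N t k j else 0) - (if j = k then twist X N t i l else 0) := by
  set B := twist X N t
  have hrow : ∀ j, j ≠ N → B N j = ⁅t, X N j⁆ := fun j => twist_row
  have hcol : ∀ j, j ≠ N → B j N = ⁅X j N, t⁆ := fun j => twist_col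
  have hNN : B N N = t := twist_self
  have hne : ∀ i j, i ≠ N → j ≠ N → B i j = ⁅X i N, B N j⁆ + if i = j then t else 0 :=
    fun i j => twist_of_ne
  have hne' : ∀ i j, i ≠ N → j ≠ N → B i j = ⁅B i N, X N j⁆ + if i = j then t else 0 :=
    fun i j => twist_of_ne' hX h0 hN
  have ite_lie' : ∀ (p : Prop) [Decidable p] (x y : L),
      ⁅(if p then x else 0), y⁆ = if p then ⁅x, y⁆ else 0 := by
    intro p _ x y; split_ifs <;> simp
  have lie_ite' : ∀ (p : Prop) [Decidable p] (x y : L),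
      ⁅y, (if p then x else 0)⁆ = if p then ⁅y, x⁆ else 0 := by
    intro p _ x y; split_ifs <;> simp
  -- the action on the row and the column of `N`
  have act_t : ∀ k l, ⁅X k l, B N N⁆ =
      (if l = N then B k N else 0) - (if N = k then B N l else 0) := by
    intro k l
    rw [hNN]
    by_cases hk : k = N
    · subst hk
      by_cases hl : l = k
      · subst hl
        simp [hN]
      · rw [if_neg hl, if_pos rfl, hrow l hl, zero_sub, lie_skew]
    · by_cases hl : l = N
      · subst hl
        rw [if_pos rfl, if_neg (Ne.symm hk), sub_zero, hcol k hk]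
      · rw [if_neg hl, if_neg (Ne.symm hk), sub_zero, h0 k l hk hl]
  have act_col : ∀ k l i, ⁅X k l, B i N⁆ =
      (if l = i then B k N else 0) - (if N = k then B i l else 0) := by
    intro k l i
    by_cases hi : i = N
    · rw [hi, act_t]
    rw [hcol i hi, leibniz_lie, hX]
    by_cases hk : k = N
    · subst hk
      by_cases hl : l = k
      · subst hl
        simp [hN, Ne.symm hi, hcol i hi]
      · have h1 : ⁅X k l, t⁆ = -B k l := by rw [hrow l hl, lie_skew]
        have h2 := h0 i l hi hl
        have h3 := hne i l hi hl
        simp only [if_true, sub_lie, h2, h1, h3, ite_lie', hN, lie_neg, hNN]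
        grind
    · have hk' := Ne.symm hk
      by_cases hl : l = N
      · subst hl
        simp [hQ i k hi hk, hk', Ne.symm hi]
      · simp [h0 k l hk hl, hk', ite_lie', hcol k hk]
  have act_row : ∀ k l j, ⁅X k l, B N j⁆ =
      (if l = N then B k j else 0) - (if j = k then B N l else 0) := by
    intro k l j
    by_cases hj : j = N
    · rw [hj, act_t]
    rw [hrow j hj]
    by_cases hk : k = N
    · subst hk
      by_cases hl : l = k
      · subst hl
        rw [leibniz_lie, hX]
        simp [hN, hj, hrow j hj]
      · rw [← lie_skew t, lie_neg, hQ' l j hl hj]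
        simp [hl, hj]
    · by_cases hl : l = N
      · subst hl
        rw [← hrow j hj, hne k j hk hj, hNN]
        grind
      · rw [leibniz_lie, h0 k l hk hl, hX]
        simp [hl, lie_ite', hrow l hl]
  by_cases hi : i = N
  · rw [hi, act_row]
  by_cases hj : j = N
  · rw [hj, act_col]
  by_cases hl : l = N
  · subst hl
    by_cases hk : k = l
    · subst hk
      rw [hne i j hi hj, lie_add, leibniz_lie, act_row, hX, lie_ite', hN]
      simp [Ne.symm hi, hj, -lie_skew]
    -- With the first formula for `B i j`, the bracket with `X k N` would produce another bracket of
    -- some `X i N` with an interior entry. The second formula leads only to the column, which is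
    -- known.
    · have h1 := lie_skew (B i l) (X k j)
      have h2 := lie_skew (B i l) (X l l)
      rw [act_col] at h1 h2
      rw [hne' i j hi hj, lie_add, leibniz_lie, act_col, hX, lie_sub, lie_ite', lie_ite', lie_ite',
        ← hNN, act_t, ← h1, ← h2]
      simp only [if_neg (Ne.symm hk), if_neg (Ne.symm hi), hNN, sub_zero, zero_lie, if_true,
        zero_sub, neg_neg]
      grind
  · have h1 : ∀ k, k ≠ N → B k j = ⁅X k N, B N j⁆ + if k = j then t else 0 :=
      fun k hk => hne k j hk hj
    have h2 := hne i l hi hl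
    rw [hne i j hi hj, lie_add, leibniz_lie, act_row, hX, sub_lie, lie_sub, ite_lie', ite_lie',
      lie_ite', lie_ite', lie_ite', if_neg hl, ← hNN, act_t]
    by_cases hk : k = N
    · subst hk
      have h4 := act_t k k
      simp only [if_true, act_row, hNN] at *
      grind
    · have h5 := h1 k hk
      grind

/-- It suffices to know the brackets with `t = B N N`: bracketing with `X` moves the first factor
from `B N N` to the column and row of `N`, and then to the interior. -/
theorem IsMatUnits.twist_lie_twist [IsAddTorsionFree L]
    (hB : ∀ k l i j, ⁅X k l, twist X N t i j⁆ =
      (if l = i then twist X N t k j else 0) - (if j = k then twist X N t i l else 0))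
    (hs : ∀ i, i ≠ N → ⁅t, ⁅t, X i N⁆⁆ = X i N) (hs' : ∀ j, j ≠ N → ⁅t, ⁅t, X N j⁆⁆ = X N j)
    (i j k l : ι) :
    ⁅twist X N t i j, twist X N t k l⁆ =
      (if j = k then X i l else 0) - (if l = i then X k j else 0) := by
  have hne : ∀ i j, i ≠ N → j ≠ N →
      twist X N t i j = ⁅X i N, twist X N t N j⁆ + if i = j then t else 0 := fun i j => twist_of_ne
  have hne' : ∀ i j, i ≠ N → j ≠ N →
      twist X N t i j = ⁅twist X N t i N, X N j⁆ + if i = j then t else 0 :=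
    fun i j => twist_of_ne' hX h0 hN
  have hrow : ∀ j, j ≠ N → ⁅t, twist X N t N j⁆ = X N j := fun j hj => by
    rw [twist_row hj, hs' j hj]
  have hcol : ∀ i, i ≠ N → ⁅t, twist X N t i N⁆ = -X i N := fun i hi => by
    rw [twist_col hi, ← lie_skew (X i N), lie_neg, hs i hi]
  have hself : twist X N t N N = t := twist_self
  have hBX : ∀ k l i j, ⁅twist X N t i j, X k l⁆ =
      (if j = k then twist X N t i l else 0) - (if l = i then twist X N t k j else 0) := by
    intro k l i j
    rw [← lie_skew, hB, neg_sub]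
  set B := twist X N t
  have ite_lie' : ∀ (p : Prop) [Decidable p] (x y : L),
      ⁅(if p then x else 0), y⁆ = if p then ⁅x, y⁆ else 0 := by
    intro p _ x y; split_ifs <;> simp
  have lie_ite' : ∀ (p : Prop) [Decidable p] (x y : L),
      ⁅y, (if p then x else 0)⁆ = if p then ⁅y, x⁆ else 0 := by
    intro p _ x y; split_ifs <;> simp
  have base : ∀ k l, ⁅B N N, B k l⁆ =
      (if N = k then X N l else 0) - (if l = N then X k N else 0) := by
    intro k l
    rw [hself]
    by_cases hk : k = N
    · subst hk
      by_cases hl : l = k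
      · subst hl
        simp [hself]
      · simp [hrow l hl, hl]
    · by_cases hl : l = N
      · subst hl
        simp [hcol k hk, Ne.symm hk]
      · rw [if_neg (Ne.symm hk), if_neg hl, sub_zero]
        have ht : ⁅t, if k = l then t else 0⁆ = 0 := by split_ifs <;> simp
        -- The two formulas for `B k l` yield values of `⁅t, B k l⁆` with opposite signs, so it
        -- vanishes in the absence of 2-torsion.
        have e1 : ⁅t, B k l⁆ = -⁅B k N, B N l⁆ + ⁅X k N, X N l⁆ := by
          rw [hne k l hk hl, lie_add, ht, add_zero, leibniz_lie, hrow l hl, ← hself, hBX,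
            if_pos rfl, if_neg (Ne.symm hk), zero_sub, neg_lie]
        have e2 : ⁅t, B k l⁆ = -⁅X k N, X N l⁆ + ⁅B k N, B N l⁆ := by
          rw [hne' k l hk hl, lie_add, ht, add_zero, leibniz_lie, hcol k hk, ← hself, hBX]
          simp [hl]
        have e3 : (2 : ℕ) • ⁅t, B k l⁆ = 0 := by
          rw [two_nsmul]
          nth_rewrite 1 [e1]
          rw [e2]
          abel
        exact (smul_eq_zero_iff_right two_ne_zero).1 e3
  have step : ∀ a b i j, (∀ k l, ⁅B i j, B k l⁆ =
      (if j = k then X i l else 0) - (if l = i then X k j else 0)) → ∀ k l,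
      ⁅⁅X a b, B i j⁆, B k l⁆ = (if b = i then (if j = k then X a l else 0) else 0) -
        (if b = i then (if l = a then X k j else 0) else 0) -
        (if j = a then (if b = k then X i l else 0) else 0) +
        (if j = a then (if l = i then X k b else 0) else 0) := by
    intro a b i j h k l
    rw [lie_lie, h, hB, lie_sub, lie_sub, lie_ite', lie_ite', lie_ite', lie_ite', h, h, hX, hX]
    grind
  have bcol : ∀ i, i ≠ N → ∀ k l, ⁅B i N, B k l⁆ =
      (if N = k then X i l else 0) - (if l = i then X k N else 0) := by
    intro i hi k l
    have h1 : ⁅X i N, B N N⁆ = B i N := by simp [hB, Ne.symm hi]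
    rw [← h1, step i N N N base]
    simp [Ne.symm hi]
  have brow : ∀ j, j ≠ N → ∀ k l, ⁅B N j, B k l⁆ =
      (if j = k then X N l else 0) - (if l = N then X k j else 0) := by
    intro j hj k l
    have h1 : ⁅X N j, B N N⁆ = -B N j := by simp [hB, hj]
    rw [← neg_neg (B N j), ← h1, neg_lie, step N j N N base]
    simp only [hj, if_false, if_true]
    abel
  by_cases hi : i = N
  · subst hi
    by_cases hj : j = i
    · rw [hj, base]
    · exact brow j hj k l
  · by_cases hj : j = N
    · rw [hj, bcol i hi]
    · rw [hne i j hi hj, add_lie, step i N N j (brow j hj), ite_lie', ← hself, base]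
      grind

end

end Twist

/-! ### Families that commute like `E_{i,j}` and `ε E_{i,j}`. -/

section Doubled

variable {L : Type*} [LieRing L] {ι : Type*} [DecidableEq ι]

/-- Two families with the commutation relations of `E_{i,j}` and `ε E_{i,j}`, where `ε² = 1`. -/
structure IsDoubledUnits (X B : ι → ι → L) : Prop where
  lie_left : ∀ i j k l, ⁅X i j, X k l⁆ =
    (if j = k then X i l else 0) - (if l = i then X k j else 0)
  lie_mixed : ∀ i j k l, ⁅X i j, B k l⁆ =
    (if j = k then B i l else 0) - (if l = i then B k j else 0)
  lie_right : ∀ i j k l, ⁅B i j, B k l⁆ =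
    (if j = k then X i l else 0) - (if l = i then X k j else 0)

theorem IsMatUnits.isDoubledUnits [IsAddTorsionFree L] {X : ι → ι → L} (hX : IsMatUnits X) {N : ι}
    {t : L} (h0 : ∀ k l, k ≠ N → l ≠ N → ⁅X k l, t⁆ = 0) (hN : ⁅X N N, t⁆ = 0)
    (hp : (∀ i, i = N) ∨ ∃ p, p ≠ N ∧ ⁅X p N, ⁅X p N, t⁆⁆ = 0 ∧ ⁅X N p, ⁅X N p, t⁆⁆ = 0 ∧
      ⁅t, ⁅t, X p N⁆⁆ = X p N ∧ ⁅t, ⁅t, X N p⁆⁆ = X N p) : IsDoubledUnits X (twist X N t) := by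
  have h0' : ∀ k l, k ≠ N → l ≠ N → ⁅t, X k l⁆ = 0 := fun k l hk hl => by
    rw [← lie_skew, h0 k l hk hl, neg_zero]
  have hB : ∀ i j k l, ⁅X i j, twist X N t k l⁆ =
      (if j = k then twist X N t i l else 0) - (if l = i then twist X N t k j else 0) := by
    refine hX.lie_twist h0 hN ?_ ?_
    · rcases hp with hp | ⟨p, hp, h1, -⟩
      · exact fun i j hi => absurd (hp i) hi
      · exact hX.lie_lie_eq_zero h0 hp h1
    · rcases hp with hp | ⟨p, hp, -, h2, -⟩
      · exact fun i j hi => absurd (hp i) hi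
      · intro i j hi hj
        have := hX.neg_transpose.lie_lie_eq_zero (t := t)
          (fun k l hk hl => by rw [neg_lie, h0 l k hl hk, neg_zero]) hp
          (by rw [neg_lie, neg_lie, lie_neg, neg_neg, h2]) i j hi hj
        simpa only [neg_lie, lie_neg, neg_neg] using this
  refine ⟨hX, hB, hX.twist_lie_twist h0 hN hB ?_ ?_⟩
  · rcases hp with hp | ⟨p, hp, -, -, h3, -⟩
    · exact fun i hi => absurd (hp i) hi
    · intro i hi
      -- `X i p` commutes with `t`, so (R4) passes from `p` to `i`.
      have : X i N = ⁅X i p, X p N⁆ := by simp [hX _ _, Ne.symm hi]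
      rw [this, leibniz_lie t (X i p), h0' i p hi hp, zero_lie, zero_add, leibniz_lie t (X i p),
        h0' i p hi hp, zero_lie, zero_add, h3]
  · rcases hp with hp | ⟨p, hp, -, -, -, h4⟩
    · exact fun i hi => absurd (hp i) hi
    · intro i hi
      have : X N i = ⁅X N p, X p i⁆ := by simp [hX _ _, hi]
      rw [this, leibniz_lie t (X N p), h0' p i hp hi, lie_zero, add_zero, leibniz_lie t ⁅t, X N p⁆,
        h0' p i hp hi, lie_zero, add_zero, h4]

theorem IsChevalley.exists_isDoubledUnits [IsAddTorsionFree L] {m : ℕ} {d e f : ℕ → L}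
    (h : IsChevalley (m + 1) d e f) {t : L} (htd : ∀ i, i < m + 1 → ⁅d i, t⁆ = 0)
    (hte : ∀ i, i + 1 < m → ⁅e i, t⁆ = 0) (htf : ∀ i, i + 1 < m → ⁅f i, t⁆ = 0)
    (heet : ∀ i, i + 1 = m → ⁅e i, ⁅e i, t⁆⁆ = 0) (hfft : ∀ i, i + 1 = m → ⁅f i, ⁅f i, t⁆⁆ = 0)
    (htte : ∀ i, i + 1 = m → ⁅t, ⁅t, e i⁆⁆ = e i) (httf : ∀ i, i + 1 = m → ⁅t, ⁅t, f i⁆⁆ = f i) :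
    ∃ X B : Fin (m + 1) → Fin (m + 1) → L, IsDoubledUnits X B ∧ (∀ i, X i i = d i) ∧
      (∀ i j : Fin (m + 1), (j : ℕ) = i + 1 → X i j = e i ∧ X j i = f i) ∧
      B (Fin.last m) (Fin.last m) = t := by
  obtain ⟨X, hX, hd, hef⟩ := h.exists_isMatUnits
  refine ⟨X, twist X (Fin.last m) t, hX.isDoubledUnits ?_ ?_ ?_, hd, hef, twist_self⟩
  · intro i j hi hj
    rw [ne_eq, Fin.ext_iff, Fin.val_last] at hi hj
    rcases lt_trichotomy i j with hij | hij | hij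
    · refine hX.mem_of_lt (p := fun x => ⁅x, t⁆ = 0) (fun x y => lie_eq_zero_of_lie) hij ?_
      intro k l hkl hk hl
      rw [(hef k l hkl).1]
      exact hte k (by rw [Fin.le_def] at hl; omega)
    · subst hij
      rw [hd, htd _ i.2]
    · refine hX.mem_of_gt (p := fun x => ⁅x, t⁆ = 0) (fun x y => lie_eq_zero_of_lie) hij ?_
      intro k l hkl hk hl
      rw [(hef k l hkl).2]
      exact htf k (by rw [Fin.le_def] at hl; omega)
  · rw [hd, htd _ (Fin.is_lt _)]
  · rcases m with _ | m
    · exact Or.inl fun i => by omega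
    · refine Or.inr ⟨⟨m, by omega⟩, by simp [Fin.ext_iff], ?_⟩
      rw [(hef ⟨m, by omega⟩ (Fin.last (m + 1)) rfl).1, (hef ⟨m, by omega⟩ (Fin.last (m + 1)) rfl).2]
      exact ⟨heet m rfl, hfft m rfl, htte m rfl, httf m rfl⟩

theorem IsDoubledUnits.map {M : Type*} [LieRing M] {X B : ι → ι → L} (h : IsDoubledUnits X B)
    (g : L →+ M) (hg : ∀ x y, g ⁅x, y⁆ = ⁅g x, g y⁆) :
    IsDoubledUnits (fun i j => g (X i j)) fun i j => g (B i j) where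
  lie_left i j k l := by rw [← hg, h.lie_left, map_sub, apply_ite g, apply_ite g, map_zero]
  lie_mixed i j k l := by rw [← hg, h.lie_mixed, map_sub, apply_ite g, apply_ite g, map_zero]
  lie_right i j k l := by rw [← hg, h.lie_right, map_sub, apply_ite g, apply_ite g, map_zero]

/-- A predicate closed under brackets that holds at the Chevalley generators and at `B N N` holds
for all members of the families. -/
theorem IsDoubledUnits.mem {m : ℕ} {X B : Fin (m + 1) → Fin (m + 1) → L}
    (h : IsDoubledUnits X B) {p : L → Prop} (hp : ∀ x y, p x → p y → p ⁅x, y⁆)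
    (ha : ∀ x y, p x → p y → p (x + y)) (hn : ∀ x, p x → p (-x)) (hd : ∀ i, p (X i i))
    (hef : ∀ i j : Fin (m + 1), (j : ℕ) = i + 1 → p (X i j) ∧ p (X j i))
    (ht : p (B (Fin.last m) (Fin.last m))) (i j : Fin (m + 1)) : p (X i j) ∧ p (B i j) := by
  have hX : IsMatUnits X := h.lie_left
  have h1 : ∀ i j, p (X i j) := by
    intro i j
    rcases lt_trichotomy i j with hij | hij | hij
    · exact hX.mem_of_lt hp hij fun k l hkl _ _ => (hef k l hkl).1
    · exact hij ▸ hd i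
    · exact hX.mem_of_gt hp hij fun k l hkl _ _ => (hef k l hkl).2
  have h2 : ∀ i, p (B i (Fin.last m)) := by
    intro i
    by_cases hi : i = Fin.last m
    · exact hi ▸ ht
    · have := hp _ _ (h1 i (Fin.last m)) ht
      rwa [h.lie_mixed, if_pos rfl, if_neg (Ne.symm hi), sub_zero] at this
  refine ⟨h1 i j, ?_⟩
  by_cases hj : j = Fin.last m
  · exact hj ▸ h2 i
  · have h3 := hn _ (hp _ _ (h1 (Fin.last m) j) (h2 i))
    rw [h.lie_mixed, if_pos rfl, neg_sub] at h3
    by_cases hji : j = i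
    · subst hji
      have := ha _ _ h3 ht
      rwa [if_pos rfl, sub_add_cancel] at this
    · rwa [if_neg hji, sub_zero] at h3

end Doubled

/-! ### Linear extension from matrix units. -/

section LinearCombination

open Matrix

variable {K : Type*} [CommRing K] {L : Type*} [LieRing L] [LieAlgebra K L]
  {ι : Type*} [Fintype ι]

/-- The linear map that sends the matrix units to the members of a given family. -/
def unitLift (X : ι → ι → L) : Matrix ι ι K →ₗ[K] L where
  toFun x := ∑ i, ∑ j, x i j • X i j
  map_add' x y := by simp [add_smul, Finset.sum_add_distrib]
  map_smul' c x := by simp [mul_smul, Finset.smul_sum]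

theorem unitLift_single [DecidableEq ι] (X : ι → ι → L) (i j : ι) (c : K) :
    unitLift X (single i j c) = c • X i j := by
  change ∑ k, ∑ l, single i j c k l • X k l = _
  rw [Finset.sum_eq_single i, Finset.sum_eq_single j]
  · simp
  · intro l _ hl
    simp [Ne.symm hl]
  · simp
  · intro k _ hk
    exact Finset.sum_eq_zero fun l _ => by simp [Ne.symm hk]
  · simp

theorem map_unitLift {M : Type*} [AddCommGroup M] [Module K M] (g : L →ₗ[K] M) (X : ι → ι → L)
    (x : Matrix ι ι K) : g (unitLift X x) = ∑ i, ∑ j, x i j • g (X i j) := by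
  change g (∑ i, ∑ j, x i j • X i j) = _
  simp

/-- Three families are allowed so that one computation covers `[X, X] = X`, `[X, B] = B`, `[B, X] =
B` and `[B, B] = X`. -/
theorem lie_unitLift [DecidableEq ι] {X Y Z : ι → ι → L}
    (h : ∀ i j k l, ⁅X i j, Y k l⁆ = (if j = k then Z i l else 0) - (if l = i then Z k j else 0))
    (x y : Matrix ι ι K) :
    ⁅(unitLift X x : L), (unitLift Y y : L)⁆ = unitLift Z (x * y - y * x) := by
  induction x using Matrix.induction_on' with
  | h_zero => simp
  | h_add x x' hx hx' =>
    rw [map_add, add_lie, hx, hx', ← map_add, add_mul, mul_add]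
    congr 1
    abel
  | h_std_basis i j c =>
    induction y using Matrix.induction_on' with
    | h_zero => simp
    | h_add y y' hy hy' =>
      rw [map_add, lie_add, hy, hy', ← map_add, add_mul, mul_add]
      congr 1
      abel
    | h_std_basis k l c' =>
      rw [unitLift_single, unitLift_single, smul_lie, lie_smul, h, map_sub]
      have h1 : unitLift Z (single i j c * single k l c') =
          (c * c') • (if j = k then Z i l else 0) := by
        split_ifs with hjk
        · subst hjk
          rw [single_mul_single_same, unitLift_single]
        · rw [single_mul_single_of_ne _ _ _ _ hjk, map_zero, smul_zero]
      have h2 : unitLift Z (single k l c' * single i j c) =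
          (c * c') • (if l = i then Z k j else 0) := by
        split_ifs with hjk
        · subst hjk
          rw [single_mul_single_same, unitLift_single, mul_comm]
        · rw [single_mul_single_of_ne _ _ _ _ hjk, map_zero, smul_zero]
      rw [h1, h2, smul_sub, smul_sub, smul_smul, smul_smul]

end LinearCombination

/-! ### Fixed points of `θ` as block matrices `(a b; b a)`. -/

section Blocks

open Matrix

/-- Splitting `1, …, 2n` into `i` and `2n + 1 - i` for `1 ≤ i ≤ n`. -/
def foldEquiv (n : ℕ) : Fin n ⊕ Fin n ≃ Fin (2 * n) where
  toFun := Sum.elim (fun i => ⟨i, by omega⟩) fun i => ⟨2 * n - 1 - i, by omega⟩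
  invFun k := if h : (k : ℕ) < n then Sum.inl ⟨k, h⟩ else Sum.inr ⟨2 * n - 1 - k, by omega⟩
  left_inv := by
    rintro (i | i)
    · simp
    · have := i.2
      exact (dif_neg (by simp only [Sum.elim_inr]; omega)).trans
        (congrArg Sum.inr (Fin.ext (by simp only [Sum.elim_inr]; omega)))
  right_inv k := by
    by_cases h : (k : ℕ) < n
    · simp [h]
    · simp only [h, dif_neg, not_false_eq_true, Sum.elim_inr]
      ext
      simp only
      omega

theorem rev_foldEquiv (n : ℕ) (s : Fin n ⊕ Fin n) :
    (foldEquiv n s).rev = foldEquiv n s.swap := by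
  rcases s with i | i <;> ext <;> simp [foldEquiv, Fin.val_rev] <;> omega

theorem mem_fixedSubalgebra_iff {n : ℕ} (x : Gl n) :
    x ∈ fixedSubalgebra n ↔ ∀ i j, x i.rev j.rev = x i j := by
  rw [mem_fixedSubalgebra, ← Matrix.ext_iff]
  rfl

theorem apply_swap {n : ℕ} {x : Gl n} (hx : x ∈ fixedSubalgebra n) (s r : Fin n ⊕ Fin n) :
    x (foldEquiv n s.swap) (foldEquiv n r.swap) = x (foldEquiv n s) (foldEquiv n r) := by
  rw [← rev_foldEquiv, ← rev_foldEquiv, (mem_fixedSubalgebra_iff x).1 hx]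

/-- The `n × n` block of entries `x_{i,j}`, `i, j ≤ n`. -/
def diagBlock (n : ℕ) : Gl n →ₗ[ℂ] Matrix (Fin n) (Fin n) ℂ where
  toFun x := of fun i j => x (foldEquiv n (.inl i)) (foldEquiv n (.inl j))
  map_add' _ _ := rfl
  map_smul' _ _ := rfl

/-- The `n × n` block of entries `x_{i,2n+1-j}`, `i, j ≤ n`. -/
def offBlock (n : ℕ) : Gl n →ₗ[ℂ] Matrix (Fin n) (Fin n) ℂ where
  toFun x := of fun i j => x (foldEquiv n (.inl i)) (foldEquiv n (.inr j))
  map_add' _ _ := rfl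
  map_smul' _ _ := rfl

theorem diagBlock_apply {n : ℕ} (x : Gl n) (i j : Fin n) :
    diagBlock n x i j = x (foldEquiv n (.inl i)) (foldEquiv n (.inl j)) := rfl

theorem offBlock_apply {n : ℕ} (x : Gl n) (i j : Fin n) :
    offBlock n x i j = x (foldEquiv n (.inl i)) (foldEquiv n (.inr j)) := rfl

/-- Together with `offBlock_mul` this is the product `(a + ε b)(a' + ε b')`. Only the right factor
has to be fixed, since only its lower blocks enter. -/
theorem diagBlock_mul {n : ℕ} (x : Gl n) {y : Gl n} (hy : y ∈ fixedSubalgebra n) :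
    diagBlock n (x * y) = diagBlock n x * diagBlock n y + offBlock n x * offBlock n y := by
  ext i j
  simp only [diagBlock_apply, offBlock_apply, mul_apply, Matrix.add_apply,
    ← (foldEquiv n).sum_comp, Fintype.sum_sum_type]
  congr 1
  exact Finset.sum_congr rfl fun k _ => congrArg _ (apply_swap hy (.inl k) (.inr j))

theorem offBlock_mul {n : ℕ} (x : Gl n) {y : Gl n} (hy : y ∈ fixedSubalgebra n) :
    offBlock n (x * y) = diagBlock n x * offBlock n y + offBlock n x * diagBlock n y := by
  ext i j
  simp only [diagBlock_apply, offBlock_apply, mul_apply, Matrix.add_apply,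
    ← (foldEquiv n).sum_comp, Fintype.sum_sum_type]
  congr 1
  exact Finset.sum_congr rfl fun k _ => congrArg _ (apply_swap hy (.inl k) (.inl j))

theorem fixedSubalgebra_ext {n : ℕ} {x y : fixedSubalgebra n}
    (h1 : diagBlock n x = diagBlock n y) (h2 : offBlock n x = offBlock n y) : x = y := by
  obtain ⟨x, hx⟩ := x
  obtain ⟨y, hy⟩ := y
  have key : ∀ s r, x (foldEquiv n s) (foldEquiv n r) = y (foldEquiv n s) (foldEquiv n r) := by
    rintro (i | i) (j | j)
    · exact congrFun₂ h1 i j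
    · exact congrFun₂ h2 i j
    · exact (apply_swap hx (.inl i) (.inr j)).trans
        ((congrFun₂ h2 i j).trans (apply_swap hy (.inl i) (.inr j)).symm)
    · exact (apply_swap hx (.inl i) (.inl j)).trans
        ((congrFun₂ h1 i j).trans (apply_swap hy (.inl i) (.inl j)).symm)
  refine Subtype.ext (Matrix.ext fun a b => ?_)
  simpa using key ((foldEquiv n).symm a) ((foldEquiv n).symm b)

/-- The fixed point with given diagonal and off-diagonal block. -/
def ofBlocks {n : ℕ} (a b : Matrix (Fin n) (Fin n) ℂ) : fixedSubalgebra n :=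
  ⟨reindex (foldEquiv n) (foldEquiv n) (fromBlocks a b b a), by
    rw [mem_fixedSubalgebra_iff]
    intro i j
    obtain ⟨s, rfl⟩ := (foldEquiv n).surjective i
    obtain ⟨r, rfl⟩ := (foldEquiv n).surjective j
    rw [rev_foldEquiv, rev_foldEquiv]
    rcases s with s | s <;> rcases r with r | r <;> simp⟩

theorem diagBlock_ofBlocks {n : ℕ} (a b : Matrix (Fin n) (Fin n) ℂ) :
    diagBlock n (ofBlocks a b : fixedSubalgebra n) = a := by
  ext i j
  simp [diagBlock_apply, ofBlocks]

theorem offBlock_ofBlocks {n : ℕ} (a b : Matrix (Fin n) (Fin n) ℂ) :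
    offBlock n (ofBlocks a b : fixedSubalgebra n) = b := by
  ext i j
  simp [offBlock_apply, ofBlocks]

theorem diagBlock_lie {n : ℕ} (x y : fixedSubalgebra n) :
    diagBlock n (⁅x, y⁆ : fixedSubalgebra n) =
      (diagBlock n x * diagBlock n y - diagBlock n y * diagBlock n x) +
        (offBlock n x * offBlock n y - offBlock n y * offBlock n x) := by
  rw [LieSubalgebra.coe_bracket, Ring.lie_def, map_sub, diagBlock_mul _ y.2, diagBlock_mul _ x.2]
  abel

theorem offBlock_lie {n : ℕ} (x y : fixedSubalgebra n) :
    offBlock n (⁅x, y⁆ : fixedSubalgebra n) =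
      (diagBlock n x * offBlock n y - offBlock n y * diagBlock n x) +
        (offBlock n x * diagBlock n y - diagBlock n y * offBlock n x) := by
  rw [LieSubalgebra.coe_bracket, Ring.lie_def, map_sub, offBlock_mul _ y.2, offBlock_mul _ x.2]
  abel

theorem isDoubledUnits_ofBlocks (n : ℕ) :
    IsDoubledUnits (fun i j => (ofBlocks (single i j 1) 0 : fixedSubalgebra n))
      fun i j => ofBlocks 0 (single i j 1) := by
  have hmul : ∀ i j k l : Fin n, single i j (1 : ℂ) * single k l 1 =
      if j = k then single i l 1 else 0 := by
    intro i j k l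
    split_ifs with h
    · subst h
      rw [single_mul_single_same, one_mul]
    · rw [single_mul_single_of_ne _ _ _ _ h]
  constructor <;> intro i j k l <;> apply fixedSubalgebra_ext <;>
    simp only [diagBlock_lie, offBlock_lie, diagBlock_ofBlocks, offBlock_ofBlocks, hmul] <;>
    split_ifs <;>
    simp [diagBlock_ofBlocks, offBlock_ofBlocks]

/-- The Lie algebra homomorphism from `gl_{2n}^θ` given by the images of the matrix units. -/
def IsDoubledUnits.toLieHom {n : ℕ} {L : Type*} [LieRing L] [LieAlgebra ℂ L]
    {X B : Fin n → Fin n → L} (h : IsDoubledUnits X B) : fixedSubalgebra n →ₗ⁅ℂ⁆ L where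
  toFun x := unitLift X (diagBlock n x) + unitLift B (offBlock n x)
  map_add' x y := by
    rw [show ((x + y : fixedSubalgebra n) : Gl n) = x + y from rfl]
    simp only [map_add]
    abel
  map_smul' c x := by simp
  map_lie' {x y} := by
    have h' : ∀ i j k l, ⁅B i j, X k l⁆ =
        (if j = k then B i l else 0) - (if l = i then B k j else 0) := by
      intro i j k l
      rw [← lie_skew, h.lie_mixed, neg_sub]
    simp only [diagBlock_lie, offBlock_lie, add_lie, lie_add, lie_unitLift h.lie_left,
      lie_unitLift h.lie_mixed, lie_unitLift h.lie_right, lie_unitLift h', map_add]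
    abel

theorem IsDoubledUnits.toLieHom_apply {n : ℕ} {L : Type*} [LieRing L] [LieAlgebra ℂ L]
    {X B : Fin n → Fin n → L} (h : IsDoubledUnits X B) (x : fixedSubalgebra n) :
    h.toLieHom x = unitLift X (diagBlock n x) + unitLift B (offBlock n x) := rfl

/-- The doubled units span `gl_{2n}^θ`; this is what the generation statement needs. -/
theorem eq_unitLift_add {n : ℕ} (x : fixedSubalgebra n) :
    x = unitLift (fun i j => (ofBlocks (single i j 1) 0 : fixedSubalgebra n)) (diagBlock n x) +
      unitLift (fun i j => (ofBlocks 0 (single i j 1) : fixedSubalgebra n)) (offBlock n x) := by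
  let g₁ : fixedSubalgebra n →ₗ[ℂ] Matrix (Fin n) (Fin n) ℂ :=
    { toFun := fun x => diagBlock n x, map_add' := fun _ _ => rfl, map_smul' := fun _ _ => rfl }
  let g₂ : fixedSubalgebra n →ₗ[ℂ] Matrix (Fin n) (Fin n) ℂ :=
    { toFun := fun x => offBlock n x, map_add' := fun _ _ => rfl, map_smul' := fun _ _ => rfl }
  have h1 := map_unitLift (K := ℂ) (ι := Fin n) g₁
  have h2 := map_unitLift (K := ℂ) (ι := Fin n) g₂
  have h3 : ∀ a b, g₁ (ofBlocks a b) = a := diagBlock_ofBlocks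
  have h4 : ∀ a b, g₂ (ofBlocks a b) = b := offBlock_ofBlocks
  have h5 : ∀ a : Matrix (Fin n) (Fin n) ℂ, ∑ i, ∑ j, a i j • single i j (1 : ℂ) = a := by
    intro a
    conv_rhs => rw [matrix_eq_sum_single a]
    simp
  apply fixedSubalgebra_ext
  · change _ = g₁ _
    rw [map_add, h1, h1]
    simp only [h3, h5, smul_zero, Finset.sum_const_zero, add_zero]
  · change _ = g₂ _
    rw [map_add, h2, h2]
    simp only [h4, h5, smul_zero, Finset.sum_const_zero, zero_add]

end Blocks

/-! ### The generators in block form. -/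

section Generators

open Matrix

/-- The generators as elements of `gl_{2n}^θ`. -/
def genFixed (n : ℕ) (g : Gen n) : fixedSubalgebra n := ⟨genMat n g, genMat_mem n g⟩

theorem genFixed_e {n : ℕ} (i : Fin (n - 1)) :
    genFixed n (.e i) = ofBlocks (single ⟨i, by omega⟩ ⟨i + 1, by omega⟩ 1) 0 := by
  apply fixedSubalgebra_ext <;> simp only [diagBlock_ofBlocks, offBlock_ofBlocks] <;> ext k l <;>
    simp [diagBlock_apply, offBlock_apply, genFixed, genMat,
      chevE, chevF, matUnit, foldEquiv, single_apply, Fin.ext_iff] <;>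
    grind

theorem genFixed_f {n : ℕ} (i : Fin (n - 1)) :
    genFixed n (.f i) = ofBlocks (single ⟨i + 1, by omega⟩ ⟨i, by omega⟩ 1) 0 := by
  apply fixedSubalgebra_ext <;> simp only [diagBlock_ofBlocks, offBlock_ofBlocks] <;> ext k l <;>
    simp [diagBlock_apply, offBlock_apply, genFixed, genMat,
      chevE, chevF, matUnit, foldEquiv, single_apply, Fin.ext_iff] <;>
    grind

theorem genFixed_d {n : ℕ} (i : Fin n) : genFixed n (.d i) = ofBlocks (single i i 1) 0 := by
  apply fixedSubalgebra_ext <;> simp only [diagBlock_ofBlocks, offBlock_ofBlocks] <;> ext k l <;>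
    simp [diagBlock_apply, offBlock_apply, genFixed, genMat,
      chevH, matUnit, foldEquiv, single_apply, Fin.ext_iff] <;>
    grind

/-- The index `n + 1` is the partner of `n`, so both matrix units in `t` lie in off-diagonal blocks.
-/
theorem genFixed_t (m : ℕ) :
    genFixed (m + 1) .t = ofBlocks 0 (single (Fin.last m) (Fin.last m) 1) := by
  apply fixedSubalgebra_ext <;> simp only [diagBlock_ofBlocks, offBlock_ofBlocks] <;> ext k l <;>
    simp [diagBlock_apply, offBlock_apply, genFixed, genMat,
      chevE, chevF, matUnit, foldEquiv, single_apply, Fin.ext_iff] <;>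
    grind

end Generators

/-! ### Doubled units satisfy the defining relations. -/

section Relations

variable {A : Type*} [Ring A]

theorem lie_lie_eq (x y : A) : ⁅x, ⁅x, y⁆⁆ = x ^ 2 * y - 2 * (x * y * x) + y * x ^ 2 := by
  simp only [Ring.lie_def]
  noncomm_ring

theorem lie_lie_eq' (x y : A) : ⁅x, ⁅x, y⁆⁆ = y * x ^ 2 - 2 * (x * y * x) + x ^ 2 * y := by
  rw [lie_lie_eq]
  abel

theorem IsDoubledUnits.lift_eq_of_rel [Algebra ℂ A] {m : ℕ} {X B : Fin (m + 1) → Fin (m + 1) → A}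
    (h : IsDoubledUnits X B) {g : Gen (m + 1) → A}
    (he : ∀ i : Fin m, g (.e i) = X i.castSucc i.succ)
    (hf : ∀ i : Fin m, g (.f i) = X i.succ i.castSucc) (hd : ∀ i, g (.d i) = X i i)
    (ht : g .t = B (Fin.last m) (Fin.last m)) {x y : Free (m + 1)} (hxy : Rel (m + 1) x y) :
    FreeAlgebra.lift ℂ g x = FreeAlgebra.lift ℂ g y := by
  have lX := h.lie_left
  have lXB := h.lie_mixed
  have lB := h.lie_right
  have lBX : ∀ i j k l, ⁅B i j, X k l⁆ =
      (if j = k then B i l else 0) - (if l = i then B k j else 0) := by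
    intro i j k l
    rw [← lie_skew, h.lie_mixed, neg_sub]
  have comm : ∀ a b : A, ⁅a, b⁆ = 0 → a * b = b * a := fun a b hab => sub_eq_zero.1 hab
  have he' : ∀ i : Fin (m + 1 - 1), FreeAlgebra.lift ℂ g (e i) = X i.castSucc i.succ :=
    fun i => (FreeAlgebra.lift_ι_apply g _).trans (he i)
  have hf' : ∀ i : Fin (m + 1 - 1), FreeAlgebra.lift ℂ g (f i) = X i.succ i.castSucc :=
    fun i => (FreeAlgebra.lift_ι_apply g _).trans (hf i)
  have hd' : ∀ i, FreeAlgebra.lift ℂ g (d i) = X i i :=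
    fun i => (FreeAlgebra.lift_ι_apply g _).trans (hd i)
  have ht' : FreeAlgebra.lift ℂ g t = B (Fin.last m) (Fin.last m) :=
    (FreeAlgebra.lift_ι_apply g _).trans ht
  have delta_left : ∀ (i : Fin (m + 1)) (j : Fin m),
      delta i j = if i = j.castSucc then 1 else 0 := by
    intro i j
    simp [delta, Fin.ext_iff]
  have delta_right : ∀ (i : Fin (m + 1)) (j : Fin m),
      delta i (j + 1) = if i = j.succ then 1 else 0 := by
    intro i j
    simp [delta, Fin.ext_iff]
  have cases_abs : ∀ i j : Fin m, |(i : ℤ) - (j : ℤ)| = 1 → (j : ℕ) = i + 1 ∨ (i : ℕ) = j + 1 := by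
    intro i j hij
    rcases abs_eq (zero_le_one' ℤ) |>.1 hij with h | h <;> omega
  have ne_abs : ∀ i j : Fin m, 1 < |(i : ℤ) - (j : ℤ)| →
      (i : ℕ) ≠ j + 1 ∧ (j : ℕ) ≠ i + 1 := by
    intro i j hij
    rcases lt_abs.1 hij with h | h <;> omega
  induction hxy with
  | t_d i =>
    simp only [map_mul, ht', hd']
    apply comm
    rw [lBX]
    grind
  | d_e i j =>
    simp only [map_mul, map_sub, map_smul, hd', he']
    rw [← Ring.lie_def, lX, delta_left, delta_right]
    have hne : j.castSucc ≠ Fin.succ (n := m) j := by simp [Fin.ext_iff]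
    rcases eq_or_ne i j.castSucc with rfl | h1
    · simp [hne, hne.symm]
    · rcases eq_or_ne i j.succ with rfl | h2
      · simp [hne.symm]
      · simp [h1, h2, h2.symm]
  | d_f i j =>
    simp only [map_mul, map_sub, map_smul, hd', hf']
    rw [← Ring.lie_def, lX, delta_left, delta_right]
    have hne : j.castSucc ≠ Fin.succ (n := m) j := by simp [Fin.ext_iff]
    rcases eq_or_ne i j.castSucc with rfl | h1
    · simp [hne]
    · rcases eq_or_ne i j.succ with rfl | h2
      · simp [hne, hne.symm]
      · simp [h1, h1.symm, h2]
  | t_e i hi =>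
    simp only [map_mul, ht', he']
    apply comm
    rw [lBX, if_neg, if_neg, sub_zero] <;> simp [Fin.ext_iff] <;> omega
  | t_f i hi =>
    simp only [map_mul, ht', hf']
    apply comm
    rw [lBX, if_neg, if_neg, sub_zero] <;> simp [Fin.ext_iff] <;> omega
  | e_e i j hij =>
    obtain ⟨h1, h2⟩ := ne_abs i j hij
    simp only [map_mul, he']
    apply comm
    rw [lX, if_neg, if_neg, sub_zero] <;> simp [Fin.ext_iff] <;> omega
  | f_f i j hij =>
    obtain ⟨h1, h2⟩ := ne_abs i j hij
    simp only [map_mul, hf']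
    apply comm
    rw [lX, if_neg, if_neg, sub_zero] <;> simp [Fin.ext_iff] <;> omega
  | e_f i j =>
    simp only [map_mul, map_sub, map_smul, hd', he', hf']
    rw [← Ring.lie_def, lX]
    have h1 : delta i j = if i = j then 1 else 0 := by simp [delta, Fin.ext_iff]
    rw [h1]
    by_cases hij : i = j
    · subst hij
      simp only [if_true, one_smul]
      rfl
    · rw [if_neg, if_neg, if_neg hij, sub_zero, zero_smul] <;> simpa [Fin.ext_iff, eq_comm] using hij
  | serre_e i j hij =>
    simp only [map_mul, map_sub, map_add, map_pow, map_ofNat, map_zero, he']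
    rw [← lie_lie_eq]
    rcases cases_abs i j hij with h1 | h1 <;> simp [lX, Fin.ext_iff, h1, add_assoc]
  | serre_f i j hij =>
    simp only [map_mul, map_sub, map_add, map_pow, map_ofNat, map_zero, hf']
    rw [← lie_lie_eq]
    rcases cases_abs i j hij with h1 | h1 <;> simp [lX, Fin.ext_iff, h1, add_assoc]
  | e_e_t i hi =>
    simp only [map_mul, map_sub, map_add, map_pow, map_ofNat, map_zero, he', ht']
    have h2 : Fin.last m = Fin.succ (n := m) i := Fin.ext (by simp; omega)
    rw [← lie_lie_eq, h2]
    simp [lXB, Fin.ext_iff]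
  | f_f_t i hi =>
    simp only [map_mul, map_sub, map_add, map_pow, map_ofNat, map_zero, hf', ht']
    have h2 : Fin.last m = Fin.succ (n := m) i := Fin.ext (by simp; omega)
    rw [← lie_lie_eq, h2]
    simp [lXB, Fin.ext_iff]
  | e_t_t i hi =>
    simp only [map_mul, map_sub, map_add, map_pow, map_ofNat, he', ht']
    have h2 : Fin.last m = Fin.succ (n := m) i := Fin.ext (by simp; omega)
    rw [← lie_lie_eq', h2]
    simp [lBX, lB, Fin.ext_iff]
  | f_t_t i hi =>
    simp only [map_mul, map_sub, map_add, map_pow, map_ofNat, hf', ht']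
    have h2 : Fin.last m = Fin.succ (n := m) i := Fin.ext (by simp; omega)
    rw [← lie_lie_eq', h2]
    simp [lBX, lB, Fin.ext_iff]

end Relations

/-! ### Generation of the enveloping algebra. -/

section Universal

/-- Corestricting `ι` to the subalgebra it generates and lifting gives a map whose composite with
the inclusion is the identity, by the universal property. -/
theorem adjoin_range_ι (R L : Type*) [CommRing R] [LieRing L] [LieAlgebra R L] :
    Algebra.adjoin R (Set.range (UniversalEnvelopingAlgebra.ι R : L → _)) = ⊤ := by
  set S := Algebra.adjoin R (Set.range (UniversalEnvelopingAlgebra.ι R : L → _))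
  let ι' : L →ₗ⁅R⁆ S :=
    { toFun := fun x => ⟨UniversalEnvelopingAlgebra.ι R x, Algebra.subset_adjoin ⟨x, rfl⟩⟩
      map_add' := fun x y => Subtype.ext (map_add _ x y)
      map_smul' := fun c x => Subtype.ext (map_smul _ c x)
      map_lie' := fun {x y} => Subtype.ext (LieHom.map_lie _ x y) }
  have h : S.val.comp (UniversalEnvelopingAlgebra.lift R ι') = AlgHom.id R _ := by
    ext x
    simp [ι']
  refine eq_top_iff.2 fun x _ => ?_
  rw [← AlgHom.id_apply (R := R) x, ← h]
  exact (UniversalEnvelopingAlgebra.lift R ι' x).2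

theorem adjoin_genU (m : ℕ) : Algebra.adjoin ℂ (Set.range (genU (m + 1))) = ⊤ := by
  set S := Algebra.adjoin ℂ (Set.range (genU (m + 1)))
  let p : fixedSubalgebra (m + 1) → Prop := fun x => UniversalEnvelopingAlgebra.ι ℂ x ∈ S
  have hgen : ∀ g, p (genFixed (m + 1) g) := fun g => Algebra.subset_adjoin ⟨g, rfl⟩
  -- The elements whose image lies in the subalgebra `S` are closed under brackets, so all doubled
  -- units are among them.
  have key := (isDoubledUnits_ofBlocks (m + 1)).mem (p := p)
    (fun x y hx hy => by
      change UniversalEnvelopingAlgebra.ι ℂ ⁅x, y⁆ ∈ S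
      rw [LieHom.map_lie, Ring.lie_def]
      exact sub_mem (mul_mem hx hy) (mul_mem hy hx))
    (fun x y hx hy => by
      change UniversalEnvelopingAlgebra.ι ℂ (x + y) ∈ S
      rw [map_add]
      exact add_mem hx hy)
    (fun x hx => by
      change UniversalEnvelopingAlgebra.ι ℂ (-x) ∈ S
      rw [map_neg]
      exact neg_mem hx)
    (fun i => genFixed_d i ▸ hgen (.d i))
    (fun i j hij => by
      have hj : j = ⟨i + 1, by omega⟩ := Fin.ext hij
      have h1 := genFixed_e (n := m + 1) ⟨i, by omega⟩
      have h2 := genFixed_f (n := m + 1) ⟨i, by omega⟩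
      rw [hj]
      exact ⟨h1 ▸ hgen (.e ⟨i, by omega⟩), h2 ▸ hgen (.f ⟨i, by omega⟩)⟩)
    (genFixed_t m ▸ hgen .t)
  have hall : ∀ x : fixedSubalgebra (m + 1), UniversalEnvelopingAlgebra.ι ℂ x ∈ S := by
    intro x
    rw [eq_unitLift_add x, map_add]
    have hsum := map_unitLift (K := ℂ) (ι := Fin (m + 1)) (UniversalEnvelopingAlgebra.ι ℂ :
      fixedSubalgebra (m + 1) →ₗ⁅ℂ⁆ Ui (m + 1)).toLinearMap
    refine add_mem ?_ ?_
    · refine (hsum _ _).symm ▸ ?_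
      exact sum_mem fun i _ => sum_mem fun j _ => S.smul_mem (key i j).1 _
    · refine (hsum _ _).symm ▸ ?_
      exact sum_mem fun i _ => sum_mem fun j _ => S.smul_mem (key i j).2 _
  rw [eq_top_iff, ← adjoin_range_ι, Algebra.adjoin_le_iff]
  rintro _ ⟨x, rfl⟩
  exact hall x

end Universal

/-! ### The two algebra maps. -/

section Presentation

theorem lie_lie_eq_zero_of {A : Type*} [Ring A] {x y : A}
    (h : x ^ 2 * y - 2 * (x * y * x) + y * x ^ 2 = 0) : ⁅x, ⁅x, y⁆⁆ = 0 := by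
  rw [lie_lie_eq, h]

theorem delta_sub_smul {M : Type*} [AddCommGroup M] [Module ℂ M] (i j k : ℕ) (x : M) :
    (delta i j - delta i k) • x = (if i = j then x else 0) - (if i = k then x else 0) := by
  simp only [delta, sub_smul, ite_smul, one_smul, zero_smul]

theorem neg_delta_add_smul {M : Type*} [AddCommGroup M] [Module ℂ M] (i j k : ℕ) (x : M) :
    (-delta i j + delta i k) • x = (if i = k then x else 0) - (if i = j then x else 0) := by
  rw [neg_add_eq_sub, delta_sub_smul]

theorem lie_eq_zero_of_comm {A : Type*} [Ring A] {x y : A} (h : x * y = y * x) : ⁅x, y⁆ = 0 := by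
  rw [Ring.lie_def, h, sub_self]

theorem exists_isDoubledUnits_of_rel {A : Type*} [Ring A] [Algebra ℂ A] {m : ℕ}
    (π : Free (m + 1) →ₐ[ℂ] A) (hrel : ∀ {x y}, Rel (m + 1) x y → π x = π y) :
    ∃ X B : Fin (m + 1) → Fin (m + 1) → A, IsDoubledUnits X B ∧ (∀ i, X i i = π (d i)) ∧
      (∀ i : Fin m, X i.castSucc i.succ = π (e i)) ∧
      (∀ i : Fin m, X i.succ i.castSucc = π (f i)) ∧
      B (Fin.last m) (Fin.last m) = π t := by
  -- The generators are extended by zero to all natural indices; `IsChevalley` never looks at the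
  -- added values.
  let e' : ℕ → A := fun i => if h : i < m then π (e ⟨i, h⟩) else 0
  let f' : ℕ → A := fun i => if h : i < m then π (f ⟨i, h⟩) else 0
  let d' : ℕ → A := fun i => if h : i < m + 1 then π (d ⟨i, h⟩) else 0
  have he : ∀ {i} (h : i < m), e' i = π (e ⟨i, h⟩) := fun h => dif_pos h
  have hf : ∀ {i} (h : i < m), f' i = π (f ⟨i, h⟩) := fun h => dif_pos h
  have hd : ∀ {i} (h : i < m + 1), d' i = π (d ⟨i, h⟩) := fun h => dif_pos h
  have key : IsChevalley (m + 1) d' e' f' := by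
    refine ⟨?_, ?_, ?_, ?_, ?_, ?_, ?_, ?_, ?_⟩
    · intro i j hi hj
      have := hrel (.d_e ⟨i, hi⟩ ⟨j, by omega⟩)
      rw [map_sub, map_mul, map_mul, map_smul, ← Ring.lie_def] at this
      rw [hd hi, he (by omega), this]
      exact delta_sub_smul _ _ _ _
    · intro i j hi hj
      have := hrel (.d_f ⟨i, hi⟩ ⟨j, by omega⟩)
      rw [map_sub, map_mul, map_mul, map_smul, ← Ring.lie_def] at this
      rw [hd hi, hf (by omega), this]
      exact neg_delta_add_smul _ _ _ _
    · intro i j hi hj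
      have := hrel (.e_f ⟨i, by omega⟩ ⟨j, by omega⟩)
      rw [map_sub, map_mul, map_mul, map_smul, ← Ring.lie_def, map_sub] at this
      rw [he (by omega), hf (by omega), this, hd (by omega), hd hi]
      simp only [delta]
      split_ifs <;> simp
    · intro i j hij hj
      have := hrel (.e_e ⟨i, by omega⟩ ⟨j, by omega⟩ (by simp only [lt_abs]; omega))
      rw [map_mul, map_mul] at this
      rw [he (by omega), he (by omega)]
      exact lie_eq_zero_of_comm this
    · intro i j hij hj
      have := hrel (.f_f ⟨i, by omega⟩ ⟨j, by omega⟩ (by simp only [lt_abs]; omega))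
      rw [map_mul, map_mul] at this
      rw [hf (by omega), hf (by omega)]
      exact lie_eq_zero_of_comm this
    · intro i hi
      have := hrel (.serre_e ⟨i, by omega⟩ ⟨i + 1, by omega⟩ (by simp))
      simp only [map_sub, map_add, map_mul, map_pow, map_ofNat, map_zero] at this
      rw [he (by omega), he (by omega)]
      exact lie_lie_eq_zero_of this
    · intro i hi
      have := hrel (.serre_e ⟨i + 1, by omega⟩ ⟨i, by omega⟩ (by simp))
      simp only [map_sub, map_add, map_mul, map_pow, map_ofNat, map_zero] at this
      rw [he (by omega), he (by omega)]
      exact lie_lie_eq_zero_of this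
    · intro i hi
      have := hrel (.serre_f ⟨i, by omega⟩ ⟨i + 1, by omega⟩ (by simp))
      simp only [map_sub, map_add, map_mul, map_pow, map_ofNat, map_zero] at this
      rw [hf (by omega), hf (by omega)]
      exact lie_lie_eq_zero_of this
    · intro i hi
      have := hrel (.serre_f ⟨i + 1, by omega⟩ ⟨i, by omega⟩ (by simp))
      simp only [map_sub, map_add, map_mul, map_pow, map_ofNat, map_zero] at this
      rw [hf (by omega), hf (by omega)]
      exact lie_lie_eq_zero_of this
  -- Scalars restricted from `ℂ` to `ℚ` provide the division by 2 used above.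
  have : Module ℚ (A) := Module.compHom _ (algebraMap ℚ ℂ)
  have : IsAddTorsionFree (A) := .of_module_rat _
  obtain ⟨X, B, h, hXd, hXef, hB⟩ := key.exists_isDoubledUnits (t := π t)
    (fun i hi => by
      have := hrel (.t_d ⟨i, hi⟩)
      rw [map_mul, map_mul] at this
      rw [hd hi]
      exact lie_eq_zero_of_comm this.symm)
    (fun i hi => by
      have := hrel (.t_e ⟨i, by omega⟩ (by simp only; omega))
      rw [map_mul, map_mul] at this
      rw [he (by omega)]
      exact lie_eq_zero_of_comm this.symm)
    (fun i hi => by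
      have := hrel (.t_f ⟨i, by omega⟩ (by simp only; omega))
      rw [map_mul, map_mul] at this
      rw [hf (by omega)]
      exact lie_eq_zero_of_comm this.symm)
    (fun i hi => by
      have := hrel (.e_e_t ⟨i, by omega⟩ (by simp only; omega))
      simp only [map_sub, map_add, map_mul, map_pow, map_ofNat, map_zero] at this
      rw [he (by omega)]
      exact lie_lie_eq_zero_of this)
    (fun i hi => by
      have := hrel (.f_f_t ⟨i, by omega⟩ (by simp only; omega))
      simp only [map_sub, map_add, map_mul, map_pow, map_ofNat, map_zero] at this
      rw [hf (by omega)]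
      exact lie_lie_eq_zero_of this)
    (fun i hi => by
      have := hrel (.e_t_t ⟨i, by omega⟩ (by simp only; omega))
      simp only [map_sub, map_add, map_mul, map_pow, map_ofNat] at this
      rw [he (by omega), lie_lie_eq']
      exact this)
    (fun i hi => by
      have := hrel (.f_t_t ⟨i, by omega⟩ (by simp only; omega))
      simp only [map_sub, map_add, map_mul, map_pow, map_ofNat] at this
      rw [hf (by omega), lie_lie_eq']
      exact this)
  refine ⟨X, B, h, fun i => ?_, fun i => ?_, fun i => ?_, hB⟩
  · rw [hXd, hd i.2]
  · rw [(hXef i.castSucc i.succ (by simp)).1, Fin.val_castSucc, he i.2]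
    rfl
  · rw [(hXef i.castSucc i.succ (by simp)).2, Fin.val_castSucc, hf i.2]
    rfl

theorem genU_eq (n : ℕ) (g : Gen n) : genU n g = UniversalEnvelopingAlgebra.ι ℂ (genFixed n g) :=
  rfl

/-- The homomorphism from the presented algebra to `U(gl_{2n}^θ)`. -/
theorem exists_presented_toUi (m : ℕ) : ∃ φ : Presented (m + 1) →ₐ[ℂ] Ui (m + 1),
    ∀ g, φ (Presented.gen (m + 1) g) = genU (m + 1) g := by
  have h := (isDoubledUnits_ofBlocks (m + 1)).map
    ((UniversalEnvelopingAlgebra.ι ℂ : _ →ₗ⁅ℂ⁆ Ui (m + 1)) : _ →ₗ[ℂ] Ui (m + 1)).toAddMonoidHom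
    (LieHom.map_lie (UniversalEnvelopingAlgebra.ι ℂ))
  have hrel : ∀ ⦃x y⦄, Rel (m + 1) x y →
      FreeAlgebra.lift ℂ (genU (m + 1)) x = FreeAlgebra.lift ℂ (genU (m + 1)) y := fun x y hxy =>
    h.lift_eq_of_rel
      (fun i => by rw [genU_eq, genFixed_e]; rfl) (fun i => by rw [genU_eq, genFixed_f]; rfl)
      (fun i => by rw [genU_eq, genFixed_d]; rfl) (by rw [genU_eq, genFixed_t]; rfl) hxy
  refine ⟨RingQuot.liftAlgHom ℂ ⟨FreeAlgebra.lift ℂ (genU (m + 1)), hrel⟩, fun g => ?_⟩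
  rw [Presented.gen, RingQuot.liftAlgHom_mkAlgHom_apply, FreeAlgebra.lift_ι_apply]

/-- This direction carries the completeness of the relations: the presented algebra contains doubled
units, hence receives a Lie homomorphism from `gl_{2n}^θ`. -/
theorem exists_ui_toPresented (m : ℕ) : ∃ ψ : Ui (m + 1) →ₐ[ℂ] Presented (m + 1),
    ∀ g, ψ (genU (m + 1) g) = Presented.gen (m + 1) g := by
  obtain ⟨X, B, h, hd, he, hf, ht⟩ := exists_isDoubledUnits_of_rel
    (RingQuot.mkAlgHom ℂ (Rel (m + 1))) (fun h => RingQuot.mkAlgHom_rel ℂ h)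
  refine ⟨UniversalEnvelopingAlgebra.lift ℂ h.toLieHom, fun g => ?_⟩
  rw [genU_eq, UniversalEnvelopingAlgebra.lift_ι_apply, h.toLieHom_apply]
  cases g with
  | e i =>
    rw [genFixed_e, diagBlock_ofBlocks, offBlock_ofBlocks, unitLift_single, map_zero, add_zero,
      one_smul]
    exact he i
  | f i =>
    rw [genFixed_f, diagBlock_ofBlocks, offBlock_ofBlocks, unitLift_single, map_zero, add_zero,
      one_smul]
    exact hf i
  | t =>
    rw [genFixed_t, diagBlock_ofBlocks, offBlock_ofBlocks, unitLift_single, map_zero, zero_add,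
      one_smul]
    exact ht
  | d i =>
    rw [genFixed_d, diagBlock_ofBlocks, offBlock_ofBlocks, unitLift_single, map_zero, add_zero,
      one_smul]
    exact hd i

end Presentation

end EvenFixedPoint

theorem mainTheorem3 (n : ℕ) (hn : 1 ≤ n) :
    Algebra.adjoin ℂ (Set.range (EvenFixedPoint.genU n)) = ⊤ ∧
      ∃ φ : EvenFixedPoint.Presented n ≃ₐ[ℂ] EvenFixedPoint.Ui n,
        ∀ g : EvenFixedPoint.Gen n, φ (EvenFixedPoint.Presented.gen n g) = EvenFixedPoint.genU n g := by
  obtain ⟨m, rfl⟩ := Nat.exists_eq_add_of_le' hn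
  have hgen := EvenFixedPoint.adjoin_genU m
  obtain ⟨φ, hφ⟩ := EvenFixedPoint.exists_presented_toUi m
  obtain ⟨ψ, hψ⟩ := EvenFixedPoint.exists_ui_toPresented m
  have h1 : φ.comp ψ = AlgHom.id ℂ _ := by
    refine AlgHom.ext_of_adjoin_eq_top hgen ?_
    rintro _ ⟨g, rfl⟩
    simp [hφ, hψ]
  have h2 : ψ.comp φ = AlgHom.id ℂ _ := by
    refine RingQuot.ringQuot_ext' ℂ _ _ (FreeAlgebra.hom_ext (funext fun g => ?_))
    change ψ (φ (EvenFixedPoint.Presented.gen _ g)) = EvenFixedPoint.Presented.gen _ g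
    rw [hφ, hψ]
  exact ⟨hgen, AlgEquiv.ofAlgHom φ ψ h1 h2, hφ⟩
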